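/- **Links.** Let $L=L_1\cup\dots\cup L_\ell\subset S^3\subset\mathbb C^2$ be a link of the form that Algorithm 1 outputs. That is, each component $L_k$ is parametrised by $$\gamma(t)=(z_1(t),z_2(t))=\Big(\tfrac{1+\mathrm iZ(t)}{R(t)},\tfrac{X(t)+\mathrm iY(t)}{R(t)}\Big),\qquad R=\sqrt{1+X^2+Y^2+Z^2},$$ where $X=a_0+\sum_{j=1}^N(a_j\cos jt+b_j\sin jt)$ and $Y=c_0+\sum_{j=1}^N(c_j\cos jt+d_j\sin jt)$ are real trigonometric polynomials such that $(X,Y)$ is balanced ($\sum_{j=1}^N j(a_jd_j-b_jc_j)=0$) and $(X',Y')$ never vanishes, and $Z(t)=Z(0)+\int_0^t(YX'-XY')\,ds$. Moreover each $\gamma$ is injective on $[0,2\pi)$ and the components are pairwise disjoint. (Then $Z$ is a trigonometric polynomial and $L$ is Legendrian.) Let $m_k$ be the maximal degree of $X,Y,Z$ for the $k$-th component. **Polynomials.** For $n\ge0$ and a complex vector $x=(c_{i,j})$ indexed by the pairs $0\le i,j\le n$ with $i+j$ even, put $G_x(z_1,z_2)=\sum c_{i,j}z_1^iz_2^j$.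 **The matrix.** For every $n$ there is a complex matrix $A=A_n$, with columns indexed by those pairs $(i,j)$ and with $4m_kn+1$ rows for each component $L_k$, such that for every $x$ the rows of $Ax$ belonging to $L_k$ are the coefficients of $R^{2n}G_x(z_1(t),z_2(t))$ in the basis $1,\cos t,\sin t,\dots,\cos(2m_knt),\sin(2m_knt)$. These matrices have the following properties. (i) If $x\neq0$ and $Ax=0$, then $G_x$ is a non-zero polynomial of degree at most $2n$ with $G_x|_L=0$. For all sufficiently large $n$ such an $x$ exists. (ii) For a component parametrised by $\gamma$ let $H=\gamma'\cdot v_2+\mathrm i\,\gamma'\cdot v_1$ (magnetic case) or $H=\gamma'\cdot v_1-\mathrm i\,\gamma'\cdot v_2$ (electric case), where $\cdot$ is the inner product of $\mathbb R^4=\mathbb C^2$ and $v_1=(-\overline{z_2},\overline{z_1})$, $v_2=\mathrm iv_1$. For every $n\ge1$, in each of the two cases, there is a vector $y$ whose rows belonging to $L_k$ are the coefficients of $R^{2n}H$ in the same basis, and every solution $x$ of $Ax=y$ has the following property. The polynomial $h=G_x$ has degree at most $2n$, and $\mathbf F=h(\alpha,\beta)\nabla\alpha\times\nabla\beta=\mathbf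 E_t+\mathrm i\mathbf B_t$ is a Bateman field of Hopf type with $L$ as a set of closed field lines of its magnetic (respectively electric) part. Here $$\alpha=\frac{x^2+y^2+z^2-t^2-1+2\mathrm iz}{x^2+y^2+z^2-(t-\mathrm i)^2},\qquad \beta=\frac{2(x-\mathrm iy)}{x^2+y^2+z^2-(t-\mathrm i)^2}.$$ A Bateman field of Hopf type is a field $h(\alpha,\beta)\nabla\alpha\times\nabla\beta$ for this pair, which satisfies $\nabla\alpha\times\nabla\beta=\mathrm i(\partial_t\alpha\nabla\beta-\partial_t\beta\nabla\alpha)$, and a function $h$ holomorphic on a neighbourhood of the image of $(\alpha,\beta)$. That $L\subset S^3$ is a set of closed field lines of $\mathbf V_t\in\{\mathbf E_t,\mathbf B_t\}$ means two things. First, there is a time-independent smooth vector field on $S^3$ that has all components of $L$ as periodic orbits and agrees with the pushforward of $\mathbf V_t$ by $(\alpha,\beta)|_t$ up to a positive real factor, for every $t$. Second, for every $t$ and every component $L_k$ not passing through $(1,0)$ (the point that corresponds to $\infty$), the preimage of $L_k$ under $(\alpha,\beta)|_t:\mathbb R^3\to S^3$ is a periodic orbit of $\mathbf V_t$. -/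

import Mathlib

open Real Set Matrix
open scoped ContDiff

noncomputable section

/-! ## The parametrised Legendrian links -/

/-- The Fourier data of one component: two real trigonometric polynomials
`X(t) = a₀ + ∑_{j=1}^N (a_j cos jt + b_j sin jt)`, `Y(t) = c₀ + ∑_{j=1}^N (c_j cos jt + d_j sin jt)`
(the numbers `b 0`, `d 0` and the coefficients with index above `N` play no role), together with
the initial height `Z(0)`. -/
structure FourierCurve where
  N : ℕ
  a : ℕ → ℝ
  b : ℕ → ℝ
  c : ℕ → ℝ
  d : ℕ → ℝ
  z₀ : ℝ

namespace FourierCurve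

variable (K : FourierCurve)

def X (t : ℝ) : ℝ := ∑ j ∈ Finset.range (K.N + 1), (K.a j * cos (j * t) + K.b j * sin (j * t))

def Y (t : ℝ) : ℝ := ∑ j ∈ Finset.range (K.N + 1), (K.c j * cos (j * t) + K.d j * sin (j * t))

/-- `Z(t) = Z(0) + ∫₀ᵗ (Y X' - X Y')`. -/
def Z (t : ℝ) : ℝ := K.z₀ + ∫ s in (0 : ℝ)..t, (K.Y s * deriv K.X s - K.X s * deriv K.Y s)

/-- `(X, Y)` is a balanced parametrisation. -/
def Balanced : Prop :=
  ∑ j ∈ Finset.Icc 1 K.N, (j : ℝ) * (K.a j * K.d j - K.b j * K.c j) = 0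

def R (t : ℝ) : ℝ := √(1 + K.X t ^ 2 + K.Y t ^ 2 + K.Z t ^ 2)

/-- The curve in `S³ ⊂ ℂ²` obtained from `(1 + iZ, X + iY)` by radial projection. -/
def γ (t : ℝ) : ℂ × ℂ :=
  (⟨1 / K.R t, K.Z t / K.R t⟩, ⟨K.X t / K.R t, K.Y t / K.R t⟩)

/-- The image of the curve: one component of the link. -/
def image : Set (ℂ × ℂ) := range K.γ

end FourierCurve

/-- `f` is a real trigonometric polynomial of degree at most `m`. -/
def IsTrigPolynomial (f : ℝ → ℝ) (m : ℕ) : Prop :=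
  ∃ p q : ℕ → ℝ, ∀ t, f t = ∑ j ∈ Finset.range (m + 1), (p j * cos (j * t) + q j * sin (j * t))

/-- The maximum of the degrees of the trigonometric polynomials `X`, `Y`, `Z`, i.e. the least `m`
such that all three are trigonometric polynomials of degree at most `m`. -/
def FourierCurve.deg (K : FourierCurve) : ℕ :=
  sInf {m | IsTrigPolynomial K.X m ∧ IsTrigPolynomial K.Y m ∧ IsTrigPolynomial K.Z m}

/-- The parametrised links in `S³` with `l` components of the form that the algorithm outputs: each
component comes from a balanced pair of finite Fourier series `(X, Y)` that is a regular plane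
curve, with the third coordinate obtained by integration, and the components are simple closed
curves that are pairwise disjoint. -/
structure FourierLink (l : ℕ) where
  comp : Fin l → FourierCurve
  balanced : ∀ k, (comp k).Balanced
  regular : ∀ k t, (deriv (comp k).X t, deriv (comp k).Y t) ≠ (0, 0)
  simple : ∀ k, InjOn (comp k).γ (Ico 0 (2 * π))
  disjoint : ∀ k k', k ≠ k' → Disjoint (comp k).image (comp k').image

/-- The link as a subset of `S³`. -/
def FourierLink.carrier {l : ℕ} (L : FourierLink l) : Set (ℂ × ℂ) := ⋃ k, (L.comp k).image

/-! ## The linear systems -/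

/-- The unknowns: pairs `(i, j)` with `0 ≤ i, j ≤ n` and `i + j` even. -/
abbrev EvenIndex (n : ℕ) : Type :=
  {p : Fin (n + 1) × Fin (n + 1) // Even ((p.1 : ℕ) + (p.2 : ℕ))}

/-- The polynomial `∑ c_{i,j} z₁ⁱ z₂ʲ` with the given coefficients (and `c_{i,j} = 0` for `i + j`
odd). -/
def polyOf {n : ℕ} (x : EvenIndex n → ℂ) : MvPolynomial (Fin 2) ℂ :=
  ∑ p : EvenIndex n,
    MvPolynomial.C (x p) * MvPolynomial.X 0 ^ (p.1.1 : ℕ) * MvPolynomial.X 1 ^ (p.1.2 : ℕ)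

/-- The function `ℂ² → ℂ` given by a polynomial. -/
def polyFun (G : MvPolynomial (Fin 2) ℂ) (z : ℂ × ℂ) : ℂ := MvPolynomial.eval ![z.1, z.2] G

/-- Indices of the basis `1, cos t, …, cos dt, sin t, …, sin dt`; there are `2d + 1` of them. -/
abbrev TrigIndex (d : ℕ) : Type := Fin (d + 1) ⊕ Fin d

def trigBasis {d : ℕ} : TrigIndex d → ℝ → ℝ
  | .inl k, t => cos ((k : ℕ) * t)
  | .inr k, t => sin (((k : ℕ) + 1) * t)

/-- The equations: `4 m_k n + 1` of them for the component with index `k`, where `m_k` is the degree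
of that component. -/
abbrev Row {l : ℕ} (L : FourierLink l) (n : ℕ) : Type :=
  Σ k : Fin l, TrigIndex (2 * (L.comp k).deg * n)

/-- `v` lists, component by component, the coefficients of the functions `f k` in the trigonometric
basis. -/
def IsTrigExpansion {l : ℕ} (L : FourierLink l) {n : ℕ} (f : Fin l → ℝ → ℂ)
    (v : Row L n → ℂ) : Prop :=
  ∀ k t, f k t = ∑ r : TrigIndex (2 * (L.comp k).deg * n), v ⟨k, r⟩ * (trigBasis r t : ℂ)

/-- `A` is the matrix of the linear map that sends the coefficients of a polynomial `G` to the
coefficients of the trigonometric polynomials `R^{2n} G(z₁(t), z₂(t))`, one for each component. -/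
def IsExpansionMatrix {l : ℕ} (L : FourierLink l) (n : ℕ)
    (A : Matrix (Row L n) (EvenIndex n) ℂ) : Prop :=
  ∀ x : EvenIndex n → ℂ,
    IsTrigExpansion L
      (fun k t => ((L.comp k).R t : ℂ) ^ (2 * n) * polyFun (polyOf x) ((L.comp k).γ t)) (A *ᵥ x)

/-! ## Bateman fields -/

/-- Gradient with respect to the three spatial variables. -/
def grad (f : (Fin 3 → ℝ) → ℂ) (p : Fin 3 → ℝ) : Fin 3 → ℂ :=
  fun i => fderiv ℝ f p (Pi.single i 1)

/-- `α, β` are smooth and `∇α × ∇β = i (∂ₜα ∇β - ∂ₜβ ∇α)`. The first argument is the time. -/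
def IsBatemanPair (α β : ℝ → (Fin 3 → ℝ) → ℂ) : Prop :=
  ContDiff ℝ ∞ (Function.uncurry α) ∧ ContDiff ℝ ∞ (Function.uncurry β) ∧
  ∀ t p, grad (α t) p ⨯₃ grad (β t) p =
    Complex.I • (deriv (fun s => α s p) t • grad (β t) p - deriv (fun s => β s p) t • grad (α t) p)

/-- The field `h(α, β) ∇α × ∇β`. -/
def batemanField (α β : ℝ → (Fin 3 → ℝ) → ℂ) (h : ℂ × ℂ → ℂ) (t : ℝ) (p : Fin 3 → ℝ) :
    Fin 3 → ℂ :=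
  h (α t p, β t p) • (grad (α t) p ⨯₃ grad (β t) p)

/-- `F` is the field `h(α, β) ∇α × ∇β` for a Bateman pair `(α, β)` and a function `h` that is
holomorphic on a neighbourhood of the image of `(α, β)`. -/
def IsBatemanField (α β : ℝ → (Fin 3 → ℝ) → ℂ) (F : ℝ → (Fin 3 → ℝ) → Fin 3 → ℂ) : Prop :=
  IsBatemanPair α β ∧
  ∃ (U : Set (ℂ × ℂ)) (h : ℂ × ℂ → ℂ), IsOpen U ∧ (∀ t p, (α t p, β t p) ∈ U) ∧
    DifferentiableOn ℂ h U ∧ ∀ t p, F t p = batemanField α β h t p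

/-- `α = (x² + y² + z² - t² - 1 + 2iz) / (x² + y² + z² - (t - i)²)`. -/
def hopfα (t : ℝ) (p : Fin 3 → ℝ) : ℂ :=
  ((p 0 : ℂ) ^ 2 + (p 1 : ℂ) ^ 2 + (p 2 : ℂ) ^ 2 - (t : ℂ) ^ 2 - 1 + 2 * Complex.I * (p 2 : ℂ)) /
    ((p 0 : ℂ) ^ 2 + (p 1 : ℂ) ^ 2 + (p 2 : ℂ) ^ 2 - ((t : ℂ) - Complex.I) ^ 2)

/-- `β = 2(x - iy) / (x² + y² + z² - (t - i)²)`. -/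
def hopfβ (t : ℝ) (p : Fin 3 → ℝ) : ℂ :=
  (2 * ((p 0 : ℂ) - Complex.I * (p 1 : ℂ))) /
    ((p 0 : ℂ) ^ 2 + (p 1 : ℂ) ^ 2 + (p 2 : ℂ) ^ 2 - ((t : ℂ) - Complex.I) ^ 2)

/-- The map `(α, β)` at time `t`, which identifies `ℝ³` with `S³` minus the point `(1, 0)`; the
projection `φₜ : S³ → ℝ³ ∪ {∞}` is its inverse. -/
def hopfMap (t : ℝ) (p : Fin 3 → ℝ) : ℂ × ℂ := (hopfα t p, hopfβ t p)

/-- A Bateman field of Hopf type. -/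
def IsBatemanFieldOfHopfType (F : ℝ → (Fin 3 → ℝ) → Fin 3 → ℂ) : Prop :=
  IsBatemanField hopfα hopfβ F

/-- The two parts of an electromagnetic field `F = E + iB`. -/
inductive FieldPart
  | electric
  | magnetic

def FieldPart.of : FieldPart → (ℝ → (Fin 3 → ℝ) → Fin 3 → ℂ) → ℝ → (Fin 3 → ℝ) → Fin 3 → ℝ
  | .electric, F, t, p => fun i => (F t p i).re
  | .magnetic, F, t, p => fun i => (F t p i).im

/-- `C` is a closed field line (a periodic orbit, not a rest point) of the vector field `V`. -/
def IsClosedFieldLine {E : Type*} [NormedAddCommGroup E] [NormedSpace ℝ E]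
    (V : E → E) (C : Set E) : Prop :=
  ∃ (T : ℝ) (c : ℝ → E), 0 < T ∧ (∀ s, HasDerivAt c (V (c s)) s) ∧ Function.Periodic c T ∧
    InjOn c (Ico 0 T) ∧ range c = C

/-- `W` is a time-independent smooth vector field on `S³` (extended to `ℂ²`) such that, at every
time `t`, the field `V t` on `ℝ³` is the pushforward of `W` by `φₜ`, up to a positive real factor. -/
def IsSphereField (V : ℝ → (Fin 3 → ℝ) → Fin 3 → ℝ) (W : ℂ × ℂ → ℂ × ℂ) : Prop :=
  ContDiff ℝ ∞ W ∧
  ∀ t p, ∃ ρ : ℝ, 0 < ρ ∧ fderiv ℝ (hopfMap t) p (V t p) = ρ • W (hopfMap t p)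

/-- The components of `L ⊂ S³` are closed field lines of the time-dependent field `V` on `ℝ³`:
they are periodic orbits of the corresponding field on `S³`, and at every time `t` the projection
`φₜ(K)` of a component `K` is a periodic orbit of `V t` in `ℝ³`, unless `K` passes through the point
`(1, 0)` that is projected to infinity. -/
def HasClosedFieldLines {l : ℕ} (V : ℝ → (Fin 3 → ℝ) → Fin 3 → ℝ) (L : FourierLink l) : Prop :=
  (∃ W, IsSphereField V W ∧ ∀ k, IsClosedFieldLine W (L.comp k).image) ∧
  ∀ t k, ((1, 0) : ℂ × ℂ) ∉ (L.comp k).image →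
    IsClosedFieldLine (V t) (hopfMap t ⁻¹' (L.comp k).image)

/-! ## The inhomogeneous term -/

/-- The standard real inner product on `ℂ² = ℝ⁴`. -/
def realDot (u w : ℂ × ℂ) : ℝ :=
  u.1.re * w.1.re + u.1.im * w.1.im + u.2.re * w.2.re + u.2.im * w.2.im

/-- `v₁ = -x₂ ∂_{x₁} + y₂ ∂_{y₁} + x₁ ∂_{x₂} - y₁ ∂_{y₂}`. -/
def v₁ (z : ℂ × ℂ) : ℂ × ℂ := (⟨-z.2.re, z.2.im⟩, ⟨z.1.re, -z.1.im⟩)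

/-- `v₂ = -y₂ ∂_{x₁} - x₂ ∂_{y₁} + y₁ ∂_{x₂} + x₁ ∂_{y₂}`. -/
def v₂ (z : ℂ × ℂ) : ℂ × ℂ := (⟨-z.2.im, -z.2.re⟩, ⟨z.1.im, z.1.re⟩)

/-- The function `H` on the link, as a function of the parameter: `T · v₂ + i T · v₁` for magnetic
field lines and `T · v₁ - i T · v₂` for electric ones, where `T` is the tangent vector of the
parametrisation. -/
def targetH (part : FieldPart) (K : FourierCurve) (t : ℝ) : ℂ :=
  match part with
  | .magnetic => ⟨realDot (deriv K.γ t) (v₂ (K.γ t)), realDot (deriv K.γ t) (v₁ (K.γ t))⟩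
  | .electric => ⟨realDot (deriv K.γ t) (v₁ (K.γ t)), -realDot (deriv K.γ t) (v₂ (K.γ t))⟩

end

/-! Everything rests on one complex frame. At `z` in `S³` the contact plane is the complex line
spanned by `(-z̄₂, z̄₁)`. The equation `Z' = Y X' - X Y'` says exactly that the curve is tangent to
it, so `γ' = f • (-z̄₂, z̄₁)` with `f = z₁ z₂' - z₂ z₁'` (`hasDerivAt_γ`, `γ_det_deriv`).

The electromagnetic field has the same shape on the sphere. Its electric or magnetic part is `Re (w
∇α × ∇β)`, where `w` is `h(α, β)` times a constant phase. Pairing with `∇α` and `∇β` kills the half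
that contains `w`, since both are orthogonal to `∇α × ∇β`. The conjugate half gives `w̄ (-β̄, ᾱ)` up
to a positive factor (`fderiv_hopfMap_batemanField`), and this direction field does not depend on
time. The function `H` is made so that phase times `H` is `f̄` (`phase_mul_targetH`). Hence `h = H`
on `L` forces the sphere field to equal `γ'` along `L`, and the components are orbits. The explicit
inverse `hopfInv` carries them to `ℝ³` at each time, where only a positive change of speed remains
(`isClosedFieldLine_of_reparam`).

The condition on `h` is linear in its coefficients. `R` is a square root but `R²` is a trigonometric
polynomial, so monomials of even degree become trigonometric polynomials after multiplication by
`R^{2n}` (`monomial_mem_trigSpan`); balance is what makes `Z` one. For part (i), about `n²/2`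
unknowns eventually outnumber a linear number of equations. -/

/-! ## Complex trigonometric polynomials -/

/-- The exponential `t ↦ exp (i j t)`. -/
noncomputable def expMode (j : ℤ) : ℝ → ℂ := fun t => Complex.exp ((j : ℂ) * t * Complex.I)

/-- Complex trigonometric polynomials of degree at most `m`. -/
noncomputable def trigSpan (m : ℕ) : Submodule ℂ (ℝ → ℂ) :=
  Submodule.span ℂ (expMode '' {j : ℤ | |j| ≤ m})

theorem expMode_mem {j : ℤ} {m : ℕ} (h : |j| ≤ m) : expMode j ∈ trigSpan m :=
  Submodule.subset_span ⟨j, h, rfl⟩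

theorem expMode_mul (j k : ℤ) : expMode j * expMode k = expMode (j + k) := by
  funext t
  simp only [expMode, Pi.mul_apply, ← Complex.exp_add]
  congr 1
  push_cast
  ring

theorem trigSpan_mono {m m' : ℕ} (h : m ≤ m') : trigSpan m ≤ trigSpan m' := by
  apply Submodule.span_mono
  apply Set.image_mono
  intro j hj
  exact le_trans (show |j| ≤ (m : ℤ) from hj) (by exact_mod_cast h)

theorem mul_mem_trigSpan {m m' : ℕ} {f g : ℝ → ℂ} (hf : f ∈ trigSpan m) (hg : g ∈ trigSpan m') :
    f * g ∈ trigSpan (m + m') := by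
  have h : trigSpan m * trigSpan m' ≤ trigSpan (m + m') := by
    rw [trigSpan, trigSpan, Submodule.span_mul_span, trigSpan, Submodule.span_le]
    rintro _ ⟨_, ⟨j, hj, rfl⟩, _, ⟨k, hk, rfl⟩, rfl⟩
    simp only [expMode_mul]
    apply expMode_mem
    have := abs_add_le j k
    have hj' : |j| ≤ (m : ℤ) := hj
    have hk' : |k| ≤ (m' : ℤ) := hk
    push_cast
    linarith
  exact h (Submodule.mul_mem_mul hf hg)

theorem const_mem_trigSpan (c : ℂ) (m : ℕ) : (fun _ => c) ∈ trigSpan m := by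
  have h : (fun _ : ℝ => c) = c • expMode 0 := by
    funext t
    simp [expMode]
  rw [h]
  exact Submodule.smul_mem _ _ (expMode_mem (by simp))

theorem pow_mem_trigSpan {m : ℕ} {f : ℝ → ℂ} (hf : f ∈ trigSpan m) (k : ℕ) :
    f ^ k ∈ trigSpan (m * k) := by
  induction k with
  | zero => exact const_mem_trigSpan 1 _
  | succ k ih => rw [pow_succ, mul_add, mul_one]; exact mul_mem_trigSpan ih hf

theorem cos_mem_trigSpan {j m : ℕ} (h : j ≤ m) :
    (fun t : ℝ => ((cos (j * t) : ℝ) : ℂ)) ∈ trigSpan m := by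
  have e : (fun t : ℝ => ((cos (j * t) : ℝ) : ℂ)) =
      (1 / 2 : ℂ) • (expMode j + expMode (-j)) := by
    funext t
    simp only [expMode, Pi.smul_apply, Pi.add_apply, smul_eq_mul, Complex.ofReal_cos, Complex.cos]
    push_cast
    ring_nf
  rw [e]
  exact Submodule.smul_mem _ _ (Submodule.add_mem _ (expMode_mem (by simpa using h))
    (expMode_mem (by simpa using h)))

theorem sin_mem_trigSpan {j m : ℕ} (h : j ≤ m) :
    (fun t : ℝ => ((sin (j * t) : ℝ) : ℂ)) ∈ trigSpan m := by
  have e : (fun t : ℝ => ((sin (j * t) : ℝ) : ℂ)) =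
      (Complex.I / 2 : ℂ) • (expMode (-j) - expMode j) := by
    funext t
    simp only [expMode, Pi.smul_apply, Pi.sub_apply, smul_eq_mul, Complex.ofReal_sin, Complex.sin]
    push_cast
    ring_nf
  rw [e]
  exact Submodule.smul_mem _ _ (Submodule.sub_mem _ (expMode_mem (by simpa using h))
    (expMode_mem (by simpa using h)))

theorem hasDerivAt_expMode (j : ℤ) (t : ℝ) :
    HasDerivAt (expMode j) (j * Complex.I * expMode j t) t := by
  have h : HasDerivAt (fun t : ℝ => (j : ℂ) * t * Complex.I) ((j : ℂ) * 1 * Complex.I) t :=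
    ((Complex.ofRealCLM.hasDerivAt (x := t)).const_mul (j : ℂ)).mul_const Complex.I
  have := h.cexp
  convert! this using 1
  simp only [expMode]
  ring

theorem exists_hasDerivAt_of_mem_trigSpan {m : ℕ} {f : ℝ → ℂ} (hf : f ∈ trigSpan m) :
    ∃ g ∈ trigSpan m, ∀ t, HasDerivAt f (g t) t := by
  induction hf using Submodule.span_induction with
  | mem f hf =>
    obtain ⟨j, hj, rfl⟩ := hf
    exact ⟨((j : ℂ) * Complex.I) • expMode j, Submodule.smul_mem _ _ (expMode_mem hj),
      hasDerivAt_expMode j⟩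
  | zero => exact ⟨0, Submodule.zero_mem _, fun t => hasDerivAt_const t 0⟩
  | add f₁ f₂ _ _ h₁ h₂ =>
    obtain ⟨g₁, m₁, d₁⟩ := h₁
    obtain ⟨g₂, m₂, d₂⟩ := h₂
    exact ⟨g₁ + g₂, Submodule.add_mem _ m₁ m₂, fun t => (d₁ t).add (d₂ t)⟩
  | smul c f _ h =>
    obtain ⟨g, m, d⟩ := h
    exact ⟨c • g, Submodule.smul_mem _ _ m, fun t => (d t).const_smul c⟩

/-- Dividing by `i j` integrates every mode except `j = 0`; the constant `c` collects that
obstruction. -/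
theorem exists_antideriv_of_mem_trigSpan {m : ℕ} {f : ℝ → ℂ} (hf : f ∈ trigSpan m) :
    ∃ c : ℂ, ∃ g ∈ trigSpan m, ∀ t, HasDerivAt g (f t - c) t := by
  induction hf using Submodule.span_induction with
  | mem f hf =>
    obtain ⟨j, hj, rfl⟩ := hf
    rcases eq_or_ne j 0 with rfl | h0
    · refine ⟨1, 0, Submodule.zero_mem _, fun t => ?_⟩
      convert! hasDerivAt_const t (0 : ℂ) using 1
      simp [expMode]
    · refine ⟨0, ((j : ℂ) * Complex.I)⁻¹ • expMode j, Submodule.smul_mem _ _ (expMode_mem hj),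
        fun t => ?_⟩
      have hj' : (j : ℂ) ≠ 0 := by exact_mod_cast h0
      convert! (hasDerivAt_expMode j t).const_smul ((j : ℂ) * Complex.I)⁻¹ using 1
      rw [smul_eq_mul, ← mul_assoc, inv_mul_cancel₀ (mul_ne_zero hj' Complex.I_ne_zero)]
      ring
  | zero =>
    refine ⟨0, 0, Submodule.zero_mem _, fun t => ?_⟩
    simp
  | add f₁ f₂ _ _ h₁ h₂ =>
    obtain ⟨c₁, g₁, m₁, d₁⟩ := h₁
    obtain ⟨c₂, g₂, m₂, d₂⟩ := h₂
    refine ⟨c₁ + c₂, g₁ + g₂, Submodule.add_mem _ m₁ m₂, fun t => ?_⟩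
    convert! (d₁ t).add (d₂ t) using 1
    simp only [Pi.add_apply]
    ring
  | smul c f _ h =>
    obtain ⟨c₀, g, m, d⟩ := h
    refine ⟨c * c₀, c • g, Submodule.smul_mem _ _ m, fun t => ?_⟩
    convert! (d t).const_smul c using 1
    simp only [Pi.smul_apply, smul_eq_mul]
    ring

theorem periodic_of_mem_trigSpan {m : ℕ} {f : ℝ → ℂ} (hf : f ∈ trigSpan m) :
    Function.Periodic f (2 * π) := by
  induction hf using Submodule.span_induction with
  | mem f hf =>
    obtain ⟨j, hj, rfl⟩ := hf
    intro t
    simp only [expMode]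
    rw [Complex.exp_eq_exp_iff_exists_int]
    exact ⟨j, by push_cast; ring⟩
  | zero => intro t; rfl
  | add f₁ f₂ _ _ h₁ h₂ => exact h₁.add h₂
  | smul c f _ h => exact h.smul c

theorem continuous_of_mem_trigSpan {m : ℕ} {f : ℝ → ℂ} (hf : f ∈ trigSpan m) : Continuous f := by
  obtain ⟨g, -, hg⟩ := exists_hasDerivAt_of_mem_trigSpan hf
  exact continuous_iff_continuousAt.2 fun t => (hg t).continuousAt

/-- The integral is a trigonometric polynomial plus the drift `t * c`. Over one period the first
part contributes nothing, so a vanishing mean forces `c = 0`. -/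
theorem integral_mem_trigSpan {m : ℕ} {f : ℝ → ℂ} (hf : f ∈ trigSpan m)
    (h0 : ∫ t in (0 : ℝ)..(2 * π), f t = 0) :
    (fun t : ℝ => ∫ s in (0 : ℝ)..t, f s) ∈ trigSpan m := by
  obtain ⟨c, g, hg, hd⟩ := exists_antideriv_of_mem_trigSpan hf
  have hc := continuous_of_mem_trigSpan hf
  have key : ∀ t : ℝ, ∫ s in (0 : ℝ)..t, f s = g t - g 0 + t * c := by
    intro t
    have h1 := intervalIntegral.integral_eq_sub_of_hasDerivAt (a := 0) (b := t) (fun s _ => hd s)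
      ((hc.sub continuous_const).intervalIntegrable _ _)
    rw [intervalIntegral.integral_sub (hc.intervalIntegrable _ _) (by simp)] at h1
    rw [← h1]
    simp
  have hc0 : c = 0 := by
    have h2 := key (2 * π)
    have hp := periodic_of_mem_trigSpan hg 0
    rw [zero_add] at hp
    rw [h0, hp, sub_self, zero_add] at h2
    have : ((2 * π : ℝ) : ℂ) ≠ 0 := by
      exact_mod_cast (by positivity : (2 * π : ℝ) ≠ 0)
    exact (mul_eq_zero.1 h2.symm).resolve_left this
  have e : (fun t : ℝ => ∫ s in (0 : ℝ)..t, f s) = g - fun _ => g 0 := by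
    funext t
    rw [key, hc0]
    simp
  rw [e]
  exact Submodule.sub_mem _ hg (const_mem_trigSpan _ _)

/-- Euler's formula. Existence of the coefficients suffices throughout; linear independence of the
basis is never needed. -/
theorem exists_trigBasis_expansion {d : ℕ} {f : ℝ → ℂ} (hf : f ∈ trigSpan d) :
    ∃ v : TrigIndex d → ℂ, ∀ t, f t = ∑ r, v r * (trigBasis r t : ℂ) := by
  have h : trigSpan d ≤ Submodule.span ℂ
      (range fun (r : TrigIndex d) (t : ℝ) => (trigBasis r t : ℂ)) := by
    rw [trigSpan, Submodule.span_le]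
    rintro _ ⟨j, hj, rfl⟩
    have hk : j.natAbs ≤ d := by
      have h' : |j| ≤ (d : ℤ) := hj
      rw [Int.abs_eq_natAbs] at h'
      exact_mod_cast h'
    have hcos : (fun t : ℝ => ((cos (j.natAbs * t) : ℝ) : ℂ)) ∈ Submodule.span ℂ
      (range fun (r : TrigIndex d) (t : ℝ) => (trigBasis r t : ℂ)) :=
      Submodule.subset_span ⟨.inl ⟨j.natAbs, by omega⟩, rfl⟩
    have hsin : (fun t : ℝ => ((sin (j.natAbs * t) : ℝ) : ℂ)) ∈ Submodule.span ℂ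
      (range fun (r : TrigIndex d) (t : ℝ) => (trigBasis r t : ℂ)) := by
      rcases Nat.eq_zero_or_pos j.natAbs with h0 | h0
      · rw [h0]
        convert Submodule.zero_mem _
        simp
      · refine Submodule.subset_span ⟨.inr ⟨j.natAbs - 1, by omega⟩, ?_⟩
        funext t
        have : ((j.natAbs - 1 : ℕ) : ℝ) + 1 = j.natAbs := by
          exact_mod_cast Nat.sub_add_cancel h0
        simp only [trigBasis, this]
    rw [SetLike.mem_coe]
    rcases Int.natAbs_eq j with h0 | h0
    · have e : expMode j = (fun t : ℝ => ((cos (j.natAbs * t) : ℝ) : ℂ)) +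
          Complex.I • (fun t : ℝ => ((sin (j.natAbs * t) : ℝ) : ℂ)) := by
        funext t
        have h1 : (j : ℂ) = ((j.natAbs : ℕ) : ℂ) := by
          conv_lhs => rw [h0, Int.cast_natCast]
        simp only [expMode, Complex.exp_mul_I, Pi.add_apply, Pi.smul_apply, smul_eq_mul, h1]
        push_cast
        ring
      rw [e]
      exact Submodule.add_mem _ hcos (Submodule.smul_mem _ _ hsin)
    · have e : expMode j = (fun t : ℝ => ((cos (j.natAbs * t) : ℝ) : ℂ)) -
          Complex.I • (fun t : ℝ => ((sin (j.natAbs * t) : ℝ) : ℂ)) := by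
        funext t
        have h1 : (j : ℂ) = -((j.natAbs : ℕ) : ℂ) := by
          conv_lhs => rw [h0, Int.cast_neg, Int.cast_natCast]
        simp only [expMode, Complex.exp_mul_I, Pi.sub_apply, Pi.smul_apply, smul_eq_mul]
        rw [h1, neg_mul, Complex.cos_neg, Complex.sin_neg]
        push_cast
        ring
      rw [e]
      exact Submodule.sub_mem _ hcos (Submodule.smul_mem _ _ hsin)
  obtain ⟨v, hv⟩ := (Submodule.mem_span_range_iff_exists_fun ℂ).1 (h hf)
  refine ⟨v, fun t => ?_⟩
  rw [← hv]
  simp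

theorem IsTrigPolynomial.mem_trigSpan {f : ℝ → ℝ} {m : ℕ} (h : IsTrigPolynomial f m) :
    (fun t => (f t : ℂ)) ∈ trigSpan m := by
  obtain ⟨p, q, hf⟩ := h
  have e : (fun t => (f t : ℂ)) = ∑ j ∈ Finset.range (m + 1),
      ((p j : ℂ) • (fun t : ℝ => ((cos (j * t) : ℝ) : ℂ)) +
        (q j : ℂ) • (fun t : ℝ => ((sin (j * t) : ℝ) : ℂ))) := by
    funext t
    rw [hf]
    simp only [Finset.sum_apply, Pi.add_apply, Pi.smul_apply, smul_eq_mul]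
    push_cast
    rfl
  rw [e]
  refine Submodule.sum_mem _ fun j hj => ?_
  have hj' : j ≤ m := Nat.lt_succ_iff.1 (Finset.mem_range.1 hj)
  exact Submodule.add_mem _ (Submodule.smul_mem _ _ (cos_mem_trigSpan hj'))
    (Submodule.smul_mem _ _ (sin_mem_trigSpan hj'))

theorem isTrigPolynomial_of_mem_trigSpan {f : ℝ → ℝ} {m : ℕ}
    (h : (fun t => (f t : ℂ)) ∈ trigSpan m) : IsTrigPolynomial f m := by
  obtain ⟨v, hv⟩ := exists_trigBasis_expansion h
  -- Real parts of the coefficients suffice because `f` and the basis are real. The sine basis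
  -- starts at frequency one, hence the index `j - 1`; the spurious value at `j = 0` is multiplied
  -- by `sin 0`.
  refine ⟨fun j => if hj : j < m + 1 then (v (.inl ⟨j, hj⟩)).re else 0,
    fun j => if hj : j - 1 < m then (v (.inr ⟨j - 1, hj⟩)).re else 0, fun t => ?_⟩
  have h1 := congrArg Complex.re (hv t)
  rw [Complex.ofReal_re, Complex.re_sum] at h1
  simp only [Complex.re_mul_ofReal] at h1
  rw [h1, Fintype.sum_sum_type, Finset.sum_add_distrib]
  congr 1
  · rw [Finset.sum_range]
    refine Finset.sum_congr rfl fun j _ => ?_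
    beta_reduce
    rw [dif_pos j.2]
    rfl
  · rw [Finset.sum_range, Fin.sum_univ_succ]
    simp [trigBasis]

theorem IsTrigPolynomial.mono {f : ℝ → ℝ} {m m' : ℕ} (h : IsTrigPolynomial f m) (hm : m ≤ m') :
    IsTrigPolynomial f m' :=
  isTrigPolynomial_of_mem_trigSpan (trigSpan_mono hm h.mem_trigSpan)

theorem IsTrigPolynomial.exists_hasDerivAt {f : ℝ → ℝ} {m : ℕ} (h : IsTrigPolynomial f m) :
    ∃ g : ℝ → ℝ, IsTrigPolynomial g m ∧ ∀ t, HasDerivAt f (g t) t := by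
  obtain ⟨g, hg, hd⟩ := exists_hasDerivAt_of_mem_trigSpan h.mem_trigSpan
  have hre : ∀ t, HasDerivAt f (g t).re t := fun t => by
    simpa using! (Complex.reCLM.hasFDerivAt (x := (f t : ℂ))).comp_hasDerivAt t (hd t)
  have e : ∀ t, g t = ((g t).re : ℂ) := fun t => (hd t).unique (hre t).ofReal_comp
  refine ⟨fun t => (g t).re, isTrigPolynomial_of_mem_trigSpan ?_, hre⟩
  rwa [← funext e]

/-! ## Orthogonality -/

theorem integral_cos_int_mul {n : ℤ} (hn : n ≠ 0) :
    ∫ t in (0 : ℝ)..(2 * π), cos (n * t) = 0 := by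
  have h : (n : ℝ) ≠ 0 := by exact_mod_cast hn
  have h2 : sin ((n : ℝ) * (2 * π)) = 0 := by
    have := sin_int_mul_pi (n * 2)
    rwa [Int.cast_mul, Int.cast_ofNat, mul_assoc] at this
  rw [intervalIntegral.integral_comp_mul_left (fun t => cos t) h, integral_cos, h2]
  simp

theorem integral_sin_int_mul (n : ℤ) : ∫ t in (0 : ℝ)..(2 * π), sin (n * t) = 0 := by
  rcases eq_or_ne n 0 with rfl | hn
  · simp
  have h : (n : ℝ) ≠ 0 := by exact_mod_cast hn
  rw [intervalIntegral.integral_comp_mul_left (fun t => sin t) h, integral_sin,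
    cos_int_mul_two_pi]
  simp

/-- The integral of `y x' - x y'` for single modes `x`, `y` of frequencies `j`, `k`. -/
theorem integral_mode_wronskian (j k : ℕ) (a b c d : ℝ) :
    ∫ t in (0 : ℝ)..(2 * π), ((c * cos (k * t) + d * sin (k * t)) *
        (j * (b * cos (j * t) - a * sin (j * t))) -
      (a * cos (j * t) + b * sin (j * t)) * (k * (d * cos (k * t) - c * sin (k * t)))) =
      if j = k then 2 * π * (j * (b * c - a * d)) else 0 := by
  split_ifs with h
  · subst h
    -- For equal frequencies the Wronskian is constant in `t`.
    have : ∀ t : ℝ, ((c * cos (j * t) + d * sin (j * t)) *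
        (j * (b * cos (j * t) - a * sin (j * t))) -
      (a * cos (j * t) + b * sin (j * t)) * (j * (d * cos (j * t) - c * sin (j * t)))) =
        j * (b * c - a * d) := fun t => by
      linear_combination (j * (b * c - a * d)) * sin_sq_add_cos_sq ((j : ℝ) * t)
    simp only [this, intervalIntegral.integral_const, smul_eq_mul, sub_zero]
  · have h' : (j : ℤ) + k ≠ 0 ∧ (j : ℤ) - k ≠ 0 := by omega
    -- Product-to-sum coefficients: `P`, `R` belong to frequency `j + k` and `Q`, `S` to `j - k`.
    -- Both frequencies are non-zero, so every term integrates to zero.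
    set P := (j * b * c - k * a * d - (k * b * c - j * a * d)) / 2 with hP
    set Q := (j * b * c - k * a * d + (k * b * c - j * a * d)) / 2 with hQ
    set R := (-(j * a * c) - k * b * d + (j * b * d + k * a * c)) / 2 with hR
    set S := (-(j * a * c) - k * b * d - (j * b * d + k * a * c)) / 2 with hS
    have : ∀ t : ℝ, ((c * cos (k * t) + d * sin (k * t)) *
        (j * (b * cos (j * t) - a * sin (j * t))) -
      (a * cos (j * t) + b * sin (j * t)) * (k * (d * cos (k * t) - c * sin (k * t)))) =
        P * cos (((j + k : ℤ) : ℝ) * t) + Q * cos (((j - k : ℤ) : ℝ) * t) +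
          (R * sin (((j + k : ℤ) : ℝ) * t) + S * sin (((j - k : ℤ) : ℝ) * t)) := fun t => by
      push_cast
      rw [add_mul (j : ℝ) k t, sub_mul (j : ℝ) k t, cos_add, cos_sub, sin_add, sin_sub, hP, hQ,
        hR, hS]
      ring
    simp only [this]
    rw [intervalIntegral.integral_add, intervalIntegral.integral_add,
      intervalIntegral.integral_add, intervalIntegral.integral_const_mul,
      intervalIntegral.integral_const_mul, intervalIntegral.integral_const_mul,
      intervalIntegral.integral_const_mul, integral_cos_int_mul h'.1, integral_cos_int_mul h'.2,
      integral_sin_int_mul, integral_sin_int_mul]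
    · simp
    all_goals exact Continuous.intervalIntegrable (by fun_prop) _ _

/-! ## The coordinate functions of the curve -/

namespace FourierCurve

theorem isTrigPolynomial_X (K : FourierCurve) : IsTrigPolynomial K.X K.N :=
  ⟨K.a, K.b, fun _ => rfl⟩

theorem isTrigPolynomial_Y (K : FourierCurve) : IsTrigPolynomial K.Y K.N :=
  ⟨K.c, K.d, fun _ => rfl⟩

theorem hasDerivAt_fourier_sum (N : ℕ) (p q : ℕ → ℝ) (t : ℝ) :
    HasDerivAt (fun t : ℝ => ∑ j ∈ Finset.range (N + 1), (p j * cos (j * t) + q j * sin (j * t)))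
      (∑ j ∈ Finset.range (N + 1), j * (q j * cos (j * t) - p j * sin (j * t))) t := by
  refine HasDerivAt.fun_sum fun j _ => ?_
  have h : HasDerivAt (fun t : ℝ => (j : ℝ) * t) j t := by
    simpa using (hasDerivAt_id t).const_mul (j : ℝ)
  convert! (h.cos.const_mul (p j)).add (h.sin.const_mul (q j)) using 1
  ring

/-- By bilinearity and orthogonality only equal frequencies contribute, and what they add up to is
`-2π` times the balance sum. -/
theorem integral_wronskian_eq_zero (K : FourierCurve) (hK : K.Balanced) :
    ∫ s in (0 : ℝ)..(2 * π), (K.Y s * deriv K.X s - K.X s * deriv K.Y s) = 0 := by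
  have hX : ∀ t, deriv K.X t = _ := fun t => (hasDerivAt_fourier_sum K.N K.a K.b t).deriv
  have hY : ∀ t, deriv K.Y t = _ := fun t => (hasDerivAt_fourier_sum K.N K.c K.d t).deriv
  have e : ∀ t, K.Y t * deriv K.X t - K.X t * deriv K.Y t =
      ∑ j ∈ Finset.range (K.N + 1), ∑ k ∈ Finset.range (K.N + 1),
        ((K.c k * cos (k * t) + K.d k * sin (k * t)) *
        (j * (K.b j * cos (j * t) - K.a j * sin (j * t))) -
      (K.a j * cos (j * t) + K.b j * sin (j * t)) *
        (k * (K.d k * cos (k * t) - K.c k * sin (k * t)))) := fun t => by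
    simp only [Finset.sum_sub_distrib]
    rw [hX, hY, Y, X, mul_comm, Finset.sum_mul_sum, Finset.sum_mul_sum]
    congr 1
    exact Finset.sum_congr rfl fun j _ => Finset.sum_congr rfl fun k _ => mul_comm _ _
  simp only [e]
  rw [intervalIntegral.integral_finsetSum]
  swap
  · exact fun j _ => Continuous.intervalIntegrable (by fun_prop) _ _
  have h : ∀ j ∈ Finset.range (K.N + 1), ∫ t in (0 : ℝ)..(2 * π),
      ∑ k ∈ Finset.range (K.N + 1), ((K.c k * cos (k * t) + K.d k * sin (k * t)) *
        (j * (K.b j * cos (j * t) - K.a j * sin (j * t))) -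
      (K.a j * cos (j * t) + K.b j * sin (j * t)) *
        (k * (K.d k * cos (k * t) - K.c k * sin (k * t)))) =
      -(2 * π) * (j * (K.a j * K.d j - K.b j * K.c j)) := by
    intro j hj
    rw [intervalIntegral.integral_finsetSum
      (fun j _ => Continuous.intervalIntegrable (by fun_prop) _ _)]
    simp only [integral_mode_wronskian]
    rw [Finset.sum_ite_eq, if_pos hj]
    ring
  rw [Finset.sum_congr rfl h, ← Finset.mul_sum, Finset.sum_range_eq_add_Ico _ (Nat.succ_pos _)]
  have hb : ∑ j ∈ Finset.Ico 1 (K.N + 1), (j : ℝ) * (K.a j * K.d j - K.b j * K.c j) = 0 := hK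
  rw [hb]
  simp

/-- Balance removes the mean of `Z'`, so `Z` has no linear drift. The bound `2N` is crude, but it
only serves to show that some degree exists. -/
theorem exists_isTrigPolynomial_Z (K : FourierCurve) (hK : K.Balanced) :
    ∃ m, IsTrigPolynomial K.Z m := by
  obtain ⟨X', hX', hdX⟩ := K.isTrigPolynomial_X.exists_hasDerivAt
  obtain ⟨Y', hY', hdY⟩ := K.isTrigPolynomial_Y.exists_hasDerivAt
  have hX : deriv K.X = X' := funext fun t => (hdX t).deriv
  have hY : deriv K.Y = Y' := funext fun t => (hdY t).deriv
  have h0 := K.integral_wronskian_eq_zero hK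
  rw [hX, hY] at h0
  have hf : (fun s => ((K.Y s * X' s - K.X s * Y' s : ℝ) : ℂ)) ∈ trigSpan (K.N + K.N) := by
    convert! Submodule.sub_mem _
      (mul_mem_trigSpan K.isTrigPolynomial_Y.mem_trigSpan hX'.mem_trigSpan)
      (mul_mem_trigSpan K.isTrigPolynomial_X.mem_trigSpan hY'.mem_trigSpan) using 1
    funext t
    simp
  refine ⟨K.N + K.N, isTrigPolynomial_of_mem_trigSpan ?_⟩
  convert! Submodule.add_mem _ (const_mem_trigSpan (K.z₀ : ℂ) _) (integral_mem_trigSpan hf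
    (by rw [intervalIntegral.integral_ofReal, h0, Complex.ofReal_zero])) using 1
  funext t
  simp only [Z, hX, hY, Pi.add_apply, intervalIntegral.integral_ofReal, Complex.ofReal_add]

/-- An infimum in `ℕ` is attained once the set is non-empty, which is where balance enters. -/
theorem deg_spec (K : FourierCurve) (hK : K.Balanced) :
    IsTrigPolynomial K.X K.deg ∧ IsTrigPolynomial K.Y K.deg ∧ IsTrigPolynomial K.Z K.deg := by
  obtain ⟨m, hm⟩ := K.exists_isTrigPolynomial_Z hK
  exact Nat.sInf_mem (s := {m | IsTrigPolynomial K.X m ∧ IsTrigPolynomial K.Y m ∧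
    IsTrigPolynomial K.Z m}) ⟨max K.N m, K.isTrigPolynomial_X.mono (le_max_left _ _),
    K.isTrigPolynomial_Y.mono (le_max_left _ _), hm.mono (le_max_right _ _)⟩

theorem hasDerivAt_X (K : FourierCurve) (t : ℝ) : HasDerivAt K.X (deriv K.X t) t :=
  (hasDerivAt_fourier_sum K.N K.a K.b t).differentiableAt.hasDerivAt

theorem hasDerivAt_Y (K : FourierCurve) (t : ℝ) : HasDerivAt K.Y (deriv K.Y t) t :=
  (hasDerivAt_fourier_sum K.N K.c K.d t).differentiableAt.hasDerivAt

theorem continuous_deriv_X (K : FourierCurve) : Continuous (deriv K.X) := by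
  rw [show deriv K.X = _ from funext fun t => (hasDerivAt_fourier_sum K.N K.a K.b t).deriv]
  fun_prop

theorem continuous_deriv_Y (K : FourierCurve) : Continuous (deriv K.Y) := by
  rw [show deriv K.Y = _ from funext fun t => (hasDerivAt_fourier_sum K.N K.c K.d t).deriv]
  fun_prop

theorem hasDerivAt_Z (K : FourierCurve) (t : ℝ) :
    HasDerivAt K.Z (K.Y t * deriv K.X t - K.X t * deriv K.Y t) t := by
  have hX : Continuous K.X := continuous_iff_continuousAt.2 fun t => (K.hasDerivAt_X t).continuousAt
  have hY : Continuous K.Y := continuous_iff_continuousAt.2 fun t => (K.hasDerivAt_Y t).continuousAt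
  have hc : Continuous fun s => K.Y s * deriv K.X s - K.X s * deriv K.Y s :=
    (hY.mul K.continuous_deriv_X).sub (hX.mul K.continuous_deriv_Y)
  exact (hc.integral_hasStrictDerivAt 0 t).hasDerivAt.const_add K.z₀

end FourierCurve

/-! ## The Hopf pair -/

/-- The common denominator of the two functions of the Hopf pair. -/
noncomputable def hopfDen (t : ℝ) (p : Fin 3 → ℝ) : ℂ :=
  (p 0 : ℂ) ^ 2 + (p 1 : ℂ) ^ 2 + (p 2 : ℂ) ^ 2 - ((t : ℂ) - Complex.I) ^ 2

theorem hopfDen_eq (t : ℝ) (p : Fin 3 → ℝ) :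
    hopfDen t p = ((p 0 ^ 2 + p 1 ^ 2 + p 2 ^ 2 - t ^ 2 + 1 : ℝ) : ℂ) +
      ((2 * t : ℝ) : ℂ) * Complex.I := by
  rw [hopfDen]
  push_cast
  linear_combination -Complex.I_sq

/-- The imaginary part `2t` vanishes only at `t = 0`, where the real part is at least one. -/
theorem hopfDen_ne_zero (t : ℝ) (p : Fin 3 → ℝ) : hopfDen t p ≠ 0 := by
  rw [hopfDen_eq]
  intro h
  have h1 := congrArg Complex.re h
  have h2 := congrArg Complex.im h
  simp only [Complex.add_re, Complex.add_im, Complex.ofReal_re, Complex.ofReal_im,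
    Complex.re_ofReal_mul, Complex.im_ofReal_mul, Complex.I_re, Complex.I_im, Complex.zero_re, Complex.zero_im] at h1 h2
  have h3 : t = 0 := by linarith
  subst h3
  nlinarith [sq_nonneg (p 0), sq_nonneg (p 1), sq_nonneg (p 2)]

theorem hopfα_mul_hopfDen (t : ℝ) (p : Fin 3 → ℝ) :
    hopfα t p * hopfDen t p = (p 0 : ℂ) ^ 2 + (p 1 : ℂ) ^ 2 + (p 2 : ℂ) ^ 2 - (t : ℂ) ^ 2 - 1 +
      2 * Complex.I * (p 2 : ℂ) :=
  div_mul_cancel₀ _ (hopfDen_ne_zero t p)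

theorem hopfβ_mul_hopfDen (t : ℝ) (p : Fin 3 → ℝ) :
    hopfβ t p * hopfDen t p = 2 * ((p 0 : ℂ) - Complex.I * (p 1 : ℂ)) :=
  div_mul_cancel₀ _ (hopfDen_ne_zero t p)

theorem contDiff_ofReal_coord (i : Fin 3) :
    ContDiff ℝ ∞ fun q : ℝ × (Fin 3 → ℝ) => (q.2 i : ℂ) :=
  Complex.ofRealCLM.contDiff.comp (by fun_prop)

theorem contDiff_ofReal_time :
    ContDiff ℝ ∞ fun q : ℝ × (Fin 3 → ℝ) => (q.1 : ℂ) :=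
  Complex.ofRealCLM.contDiff.comp (by fun_prop)

theorem contDiff_sq_radius : ContDiff ℝ ∞ fun q : ℝ × (Fin 3 → ℝ) =>
    (q.2 0 : ℂ) ^ 2 + (q.2 1 : ℂ) ^ 2 + (q.2 2 : ℂ) ^ 2 :=
  (((contDiff_ofReal_coord 0).pow 2).add ((contDiff_ofReal_coord 1).pow 2)).add
    ((contDiff_ofReal_coord 2).pow 2)

theorem contDiff_hopfDen : ContDiff ℝ ∞ fun q : ℝ × (Fin 3 → ℝ) => hopfDen q.1 q.2 :=
  contDiff_sq_radius.sub ((contDiff_ofReal_time.sub contDiff_const).pow 2)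

theorem contDiff_hopfα : ContDiff ℝ ∞ (Function.uncurry hopfα) := by
  have h : ContDiff ℝ ∞ fun q : ℝ × (Fin 3 → ℝ) =>
      (q.2 0 : ℂ) ^ 2 + (q.2 1 : ℂ) ^ 2 + (q.2 2 : ℂ) ^ 2 - (q.1 : ℂ) ^ 2 - 1 +
        2 * Complex.I * (q.2 2 : ℂ) :=
    ((contDiff_sq_radius.sub (contDiff_ofReal_time.pow 2)).sub contDiff_const).add
      (contDiff_const.mul (contDiff_ofReal_coord 2))
  simpa only [div_eq_mul_inv] using! h.mul (contDiff_hopfDen.inv fun q => hopfDen_ne_zero q.1 q.2)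

theorem contDiff_hopfβ : ContDiff ℝ ∞ (Function.uncurry hopfβ) := by
  have h : ContDiff ℝ ∞ fun q : ℝ × (Fin 3 → ℝ) =>
      2 * ((q.2 0 : ℂ) - Complex.I * (q.2 1 : ℂ)) :=
    contDiff_const.mul ((contDiff_ofReal_coord 0).sub
      (contDiff_const.mul (contDiff_ofReal_coord 1)))
  simpa only [div_eq_mul_inv] using! h.mul (contDiff_hopfDen.inv fun q => hopfDen_ne_zero q.1 q.2)

theorem differentiableAt_hopfα (t : ℝ) (p : Fin 3 → ℝ) : DifferentiableAt ℝ (hopfα t) p :=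
  ((contDiff_hopfα.comp (contDiff_prodMk_right t)).differentiable (by simp)).differentiableAt

theorem differentiableAt_hopfβ (t : ℝ) (p : Fin 3 → ℝ) : DifferentiableAt ℝ (hopfβ t) p :=
  ((contDiff_hopfβ.comp (contDiff_prodMk_right t)).differentiable (by simp)).differentiableAt

/-- The complexified `i`-th coordinate functional. -/
noncomputable def coordCLM (i : Fin 3) : (Fin 3 → ℝ) →L[ℝ] ℂ :=
  Complex.ofRealCLM.comp (ContinuousLinearMap.proj i)

theorem hasFDerivAt_coord (i : Fin 3) (p : Fin 3 → ℝ) :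
    HasFDerivAt (fun p : Fin 3 → ℝ => (p i : ℂ)) (coordCLM i) p :=
  (coordCLM i).hasFDerivAt

theorem hasFDerivAt_sq_radius (p : Fin 3 → ℝ) :
    HasFDerivAt (fun p : Fin 3 → ℝ => (p 0 : ℂ) ^ 2 + (p 1 : ℂ) ^ 2 + (p 2 : ℂ) ^ 2)
      ((2 * (p 0 : ℂ)) • coordCLM 0 + (2 * (p 1 : ℂ)) • coordCLM 1 + (2 * (p 2 : ℂ)) • coordCLM 2)
      p := by
  simpa using! (((hasFDerivAt_coord 0 p).pow 2).add ((hasFDerivAt_coord 1 p).pow 2)).add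
    ((hasFDerivAt_coord 2 p).pow 2)

/-- Differentiating the polynomial identity for `α D`, with `D` the denominator, and solving avoids
the quotient rule and keeps `α` itself in the formula. -/
theorem fderiv_hopfα_apply (t : ℝ) (p v : Fin 3 → ℝ) :
    fderiv ℝ (hopfα t) p v = 2 / hopfDen t p *
      ((1 - hopfα t p) * (p 0 * v 0 + p 1 * v 1 + p 2 * v 2) + Complex.I * v 2) := by
  have h1 := (differentiableAt_hopfα t p).hasFDerivAt.mul
    ((hasFDerivAt_sq_radius p).sub_const (((t : ℂ) - Complex.I) ^ 2))
  have h2 := ((((hasFDerivAt_sq_radius p).sub_const ((t : ℂ) ^ 2)).sub_const 1).add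
    ((hasFDerivAt_coord 2 p).const_mul (2 * Complex.I)))
  have h3 := h1.unique (h2.congr_of_eventuallyEq
    (Filter.Eventually.of_forall fun q => hopfα_mul_hopfDen t q))
  have h4 := congrArg (fun L => L v) h3
  have hD := hopfDen_ne_zero t p
  simp [coordCLM] at h4
  rw [← hopfDen] at h4
  field_simp
  linear_combination h4

theorem fderiv_hopfβ_apply (t : ℝ) (p v : Fin 3 → ℝ) :
    fderiv ℝ (hopfβ t) p v = 2 / hopfDen t p *
      ((v 0 - Complex.I * v 1) - hopfβ t p * (p 0 * v 0 + p 1 * v 1 + p 2 * v 2)) := by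
  have h1 := (differentiableAt_hopfβ t p).hasFDerivAt.mul
    ((hasFDerivAt_sq_radius p).sub_const (((t : ℂ) - Complex.I) ^ 2))
  have h2 := ((hasFDerivAt_coord 0 p).sub ((hasFDerivAt_coord 1 p).const_mul Complex.I)).const_mul 2
  have h3 := h1.unique (h2.congr_of_eventuallyEq
    (Filter.Eventually.of_forall fun q => hopfβ_mul_hopfDen t q))
  have h4 := congrArg (fun L => L v) h3
  have hD := hopfDen_ne_zero t p
  simp [coordCLM] at h4
  rw [← hopfDen] at h4
  field_simp
  linear_combination h4

theorem grad_hopfα (t : ℝ) (p : Fin 3 → ℝ) :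
    grad (hopfα t) p = ![2 / hopfDen t p * ((1 - hopfα t p) * p 0),
      2 / hopfDen t p * ((1 - hopfα t p) * p 1),
      2 / hopfDen t p * ((1 - hopfα t p) * p 2 + Complex.I)] := by
  funext i
  rw [grad, fderiv_hopfα_apply]
  fin_cases i <;> simp

theorem grad_hopfβ (t : ℝ) (p : Fin 3 → ℝ) :
    grad (hopfβ t) p = ![2 / hopfDen t p * (1 - hopfβ t p * p 0),
      2 / hopfDen t p * (-Complex.I - hopfβ t p * p 1),
      2 / hopfDen t p * (-(hopfβ t p * p 2))] := by
  funext i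
  rw [grad, fderiv_hopfβ_apply]
  fin_cases i <;> simp

theorem hasDerivAt_hopfDen_time (t : ℝ) (p : Fin 3 → ℝ) :
    HasDerivAt (fun s => hopfDen s p) (-(2 * ((t : ℂ) - Complex.I))) t := by
  have h := ((Complex.ofRealCLM.hasDerivAt (x := t)).sub_const Complex.I).pow 2
  simpa using! h.const_sub ((p 0 : ℂ) ^ 2 + (p 1 : ℂ) ^ 2 + (p 2 : ℂ) ^ 2)

theorem deriv_hopfα_time (t : ℝ) (p : Fin 3 → ℝ) :
    deriv (fun s => hopfα s p) t =
      (2 * ((t : ℂ) - Complex.I) * hopfα t p - 2 * t) / hopfDen t p := by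
  have hd : DifferentiableAt ℝ (fun s => hopfα s p) t :=
    ((contDiff_hopfα.comp (contDiff_prodMk_left p)).differentiable (by simp)).differentiableAt
  have h1 := hd.hasDerivAt.mul (hasDerivAt_hopfDen_time t p)
  have h2 : HasDerivAt (fun s : ℝ => (p 0 : ℂ) ^ 2 + (p 1 : ℂ) ^ 2 + (p 2 : ℂ) ^ 2 - (s : ℂ) ^ 2 -
      1 + 2 * Complex.I * (p 2 : ℂ)) (-(2 * (t : ℂ))) t := by
    have h := (Complex.ofRealCLM.hasDerivAt (x := t)).pow 2
    convert! ((h.const_sub ((p 0 : ℂ) ^ 2 + (p 1 : ℂ) ^ 2 + (p 2 : ℂ) ^ 2)).sub_const 1).add_const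
      (2 * Complex.I * (p 2 : ℂ)) using 1
    simp
  have h3 := h1.unique (h2.congr_of_eventuallyEq
    (Filter.Eventually.of_forall fun s => hopfα_mul_hopfDen s p))
  have hD := hopfDen_ne_zero t p
  field_simp
  linear_combination h3

theorem deriv_hopfβ_time (t : ℝ) (p : Fin 3 → ℝ) :
    deriv (fun s => hopfβ s p) t =
      2 * ((t : ℂ) - Complex.I) * hopfβ t p / hopfDen t p := by
  have hd : DifferentiableAt ℝ (fun s => hopfβ s p) t :=
    ((contDiff_hopfβ.comp (contDiff_prodMk_left p)).differentiable (by simp)).differentiableAt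
  have h1 := hd.hasDerivAt.mul (hasDerivAt_hopfDen_time t p)
  have h2 := hasDerivAt_const t (2 * ((p 0 : ℂ) - Complex.I * (p 1 : ℂ)))
  have h3 := h1.unique (h2.congr_of_eventuallyEq
    (Filter.Eventually.of_forall fun s => hopfβ_mul_hopfDen s p))
  have hD := hopfDen_ne_zero t p
  field_simp
  linear_combination h3

theorem isBatemanPair_hopf : IsBatemanPair hopfα hopfβ := by
  refine ⟨contDiff_hopfα, contDiff_hopfβ, fun t p => ?_⟩
  have hD := hopfDen_ne_zero t p
  have hα : hopfα t p = ((p 0 : ℂ) ^ 2 + (p 1 : ℂ) ^ 2 + (p 2 : ℂ) ^ 2 - (t : ℂ) ^ 2 - 1 +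
      2 * Complex.I * (p 2 : ℂ)) / hopfDen t p := rfl
  have hβ : hopfβ t p = (2 * ((p 0 : ℂ) - Complex.I * (p 1 : ℂ))) / hopfDen t p := rfl
  rw [grad_hopfα, grad_hopfβ, deriv_hopfα_time, deriv_hopfβ_time, cross_apply, hα, hβ]
  have hDe : hopfDen t p = (p 0 : ℂ) ^ 2 + (p 1 : ℂ) ^ 2 + (p 2 : ℂ) ^ 2 -
    ((t : ℂ) - Complex.I) ^ 2 := rfl
  -- With `I` replaced by a symbol of square `-1`, each component is an identity of rational
  -- functions.
  generalize hopfDen t p = D at *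
  generalize (p 0 : ℂ) = x at *
  generalize (p 1 : ℂ) = y at *
  generalize (p 2 : ℂ) = z at *
  generalize (t : ℂ) = s at *
  have hI := Complex.I_sq
  generalize Complex.I = j at *
  funext i
  fin_cases i
  · simp
    field_simp
    subst hDe
    grind
  · simp
    field_simp
    subst hDe
    grind
  · simp
    field_simp
    subst hDe
    grind

/-! ## The push-forward of the field to the sphere -/

theorem conj_hopfDen (t : ℝ) (p : Fin 3 → ℝ) : (starRingEnd ℂ) (hopfDen t p) =
    (p 0 : ℂ) ^ 2 + (p 1 : ℂ) ^ 2 + (p 2 : ℂ) ^ 2 - ((t : ℂ) + Complex.I) ^ 2 := by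
  simp [hopfDen]

/-- The factor by which the push-forward stretches the field. -/
noncomputable def hopfFactor (t : ℝ) (p : Fin 3 → ℝ) : ℝ :=
  8 * (p 0 ^ 2 + p 1 ^ 2 + (p 2 - t) ^ 2 + 1) / Complex.normSq (hopfDen t p) ^ 2

theorem hopfFactor_pos (t : ℝ) (p : Fin 3 → ℝ) : 0 < hopfFactor t p := by
  have := Complex.normSq_pos.2 (hopfDen_ne_zero t p)
  unfold hopfFactor
  positivity

theorem continuous_hopfFactor (t : ℝ) : Continuous (hopfFactor t) := by
  have h : Continuous (hopfDen t) := by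
    unfold hopfDen
    fun_prop
  refine Continuous.div (by fun_prop) ((Complex.continuous_normSq.comp h).pow 2) fun p => ?_
  exact pow_ne_zero 2 (Complex.normSq_pos.2 (hopfDen_ne_zero t p)).ne'

/-- First entry of the frame vector `(-β̄, ᾱ)`. Conjugates are treated as independent variables,
tied only by the cleared equations for `α`, `β` and their conjugates. -/
theorem grad_hopfα_dot_conj_cross (t : ℝ) (p : Fin 3 → ℝ) :
    ∑ i, grad (hopfα t) p i * (starRingEnd ℂ) ((grad (hopfα t) p ⨯₃ grad (hopfβ t) p) i) =
      -(2 * hopfFactor t p * (starRingEnd ℂ) (hopfβ t p)) := by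
  have hD := hopfDen_ne_zero t p
  have hE : (starRingEnd ℂ) (hopfDen t p) ≠ 0 := (map_ne_zero _).2 hD
  have hα := hopfα_mul_hopfDen t p
  have hα' := congrArg (starRingEnd ℂ) hα
  have hβ' := congrArg (starRingEnd ℂ) (hopfβ_mul_hopfDen t p)
  have hN : (Complex.normSq (hopfDen t p) : ℂ) = hopfDen t p * (starRingEnd ℂ) (hopfDen t p) :=
    Complex.normSq_eq_conj_mul_self.trans (mul_comm _ _)
  rw [grad_hopfα, grad_hopfβ, cross_apply, hopfFactor, Fin.sum_univ_three]
  simp only [Matrix.cons_val, map_div₀, map_sub, map_add, map_mul, map_pow, map_neg,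
    Complex.conj_ofReal, Complex.conj_I, map_ofNat, map_one] at hα' hβ' ⊢
  push_cast
  rw [hN]
  have hDe : hopfDen t p = (p 0 : ℂ) ^ 2 + (p 1 : ℂ) ^ 2 + (p 2 : ℂ) ^ 2 -
    ((t : ℂ) - Complex.I) ^ 2 := rfl
  have hEe := conj_hopfDen t p
  generalize (starRingEnd ℂ) (hopfDen t p) = E at *
  generalize hopfDen t p = D at *
  generalize (starRingEnd ℂ) (hopfα t p) = a' at *
  generalize (starRingEnd ℂ) (hopfβ t p) = b' at *
  generalize hopfα t p = a at *
  generalize (p 0 : ℂ) = x at *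
  generalize (p 1 : ℂ) = y at *
  generalize (p 2 : ℂ) = z at *
  generalize (t : ℂ) = s at *
  have hI := Complex.I_sq
  generalize Complex.I = j at *
  -- The left side is `2 (1 - Re α) |D|²`; this is the source of the positive numerator of
  -- `hopfFactor`.
  have hA : (2 - a - a') * (D * E) = 4 * (x ^ 2 + y ^ 2 + (z - s) ^ 2 + 1) := by
    have : (2 - a - a') * (D * E) = 2 * D * E - (a * D) * E - (a' * E) * D := by ring
    rw [this, hα, hα', hDe, hEe]
    clear * - hI
    grind
  trans -(4 * (2 - a - a') * (b' * E) / (D * E ^ 2))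
  · rw [hβ']
    field_simp
    clear * - hI
    grind
  · field_simp
    linear_combination (-4 * b') * hA

theorem grad_hopfβ_dot_conj_cross (t : ℝ) (p : Fin 3 → ℝ) :
    ∑ i, grad (hopfβ t) p i * (starRingEnd ℂ) ((grad (hopfα t) p ⨯₃ grad (hopfβ t) p) i) =
      2 * hopfFactor t p * (starRingEnd ℂ) (hopfα t p) := by
  have hD := hopfDen_ne_zero t p
  have hE : (starRingEnd ℂ) (hopfDen t p) ≠ 0 := (map_ne_zero _).2 hD
  have hβ := hopfβ_mul_hopfDen t p
  have hα' := congrArg (starRingEnd ℂ) (hopfα_mul_hopfDen t p)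
  have hβ' := congrArg (starRingEnd ℂ) hβ
  have hN : (Complex.normSq (hopfDen t p) : ℂ) = hopfDen t p * (starRingEnd ℂ) (hopfDen t p) :=
    Complex.normSq_eq_conj_mul_self.trans (mul_comm _ _)
  rw [grad_hopfα, grad_hopfβ, cross_apply, hopfFactor, Fin.sum_univ_three]
  simp only [Matrix.cons_val, map_div₀, map_sub, map_add, map_mul, map_pow, map_neg,
    Complex.conj_ofReal, Complex.conj_I, map_ofNat, map_one] at hα' hβ' ⊢
  push_cast
  rw [hN]
  have hDe : hopfDen t p = (p 0 : ℂ) ^ 2 + (p 1 : ℂ) ^ 2 + (p 2 : ℂ) ^ 2 -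
    ((t : ℂ) - Complex.I) ^ 2 := rfl
  have hEe := conj_hopfDen t p
  generalize (starRingEnd ℂ) (hopfDen t p) = E at *
  generalize hopfDen t p = D at *
  generalize (starRingEnd ℂ) (hopfα t p) = a' at *
  generalize (starRingEnd ℂ) (hopfβ t p) = b' at *
  generalize hopfβ t p = b at *
  generalize (p 0 : ℂ) = x at *
  generalize (p 1 : ℂ) = y at *
  generalize (p 2 : ℂ) = z at *
  generalize (t : ℂ) = s at *
  have hI := Complex.I_sq
  generalize Complex.I = j at *
  -- The bracket is what remains of the pairing after the denominators are pulled out. Multiplying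
  -- by the conjugate denominator `E` makes the claim polynomial.
  have hdet : (-2 - 2 * j * z * (1 - a') + b' * (x - j * y) + b * (x + j * y)) * D =
      2 * (x ^ 2 + y ^ 2 + (z - s) ^ 2 + 1) * a' := by
    refine mul_right_cancel₀ hE ?_
    have : (-2 - 2 * j * z * (1 - a') + b' * (x - j * y) + b * (x + j * y)) * D * E =
        -2 * D * E - 2 * j * z * (E - a' * E) * D + (b' * E) * (x - j * y) * D +
          (b * D) * (x + j * y) * E := by ring
    rw [this, mul_assoc _ a' E, hα', hβ, hβ', hDe, hEe]
    clear * - hI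
    grind
  trans 8 * (-2 - 2 * j * z * (1 - a') + b' * (x - j * y) + b * (x + j * y)) / (D * E ^ 2)
  · field_simp
    clear * - hI
    grind
  · field_simp
    linear_combination hdet

/-- The factor by which a field has to be multiplied such that the chosen part is its real part. -/
noncomputable def FieldPart.phase : FieldPart → ℂ
  | .electric => 1
  | .magnetic => -Complex.I

theorem FieldPart.of_apply (part : FieldPart) (F : ℝ → (Fin 3 → ℝ) → Fin 3 → ℂ) (t : ℝ)
    (p : Fin 3 → ℝ) (i : Fin 3) : part.of F t p i = (part.phase * F t p i).re := by
  cases part <;> simp [FieldPart.of, FieldPart.phase]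

theorem fderiv_apply_eq_sum_grad (f : (Fin 3 → ℝ) → ℂ) (p v : Fin 3 → ℝ) :
    fderiv ℝ f p v = ∑ i, grad f p i * v i := by
  conv_lhs => rw [← Finset.univ_sum_single v, map_sum]
  refine Finset.sum_congr rfl fun i _ => ?_
  have h : (Pi.single i (v i) : Fin 3 → ℝ) = v i • Pi.single i 1 := by
    rw [← Pi.single_smul, smul_eq_mul, mul_one]
  rw [h, map_smul, grad, Complex.real_smul, mul_comm]

/-- Splits the pairing with a real part into a term with `F` and one with its conjugate; for the
fields in question the first vanishes. -/
theorem sum_mul_re_mul (g F : Fin 3 → ℂ) (w : ℂ) :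
    ∑ i, g i * (((w * F i).re : ℝ) : ℂ) =
      (w * ∑ i, g i * F i + (starRingEnd ℂ) w * ∑ i, g i * (starRingEnd ℂ) (F i)) / 2 := by
  simp only [Complex.re_eq_add_conj, map_mul, Fin.sum_univ_three]
  ring

/-- The vector field on the sphere that corresponds to the chosen part of the field
`h(α, β) ∇α × ∇β` of the Hopf pair. -/
noncomputable def sphereField (part : FieldPart) (h : ℂ × ℂ → ℂ) (z : ℂ × ℂ) : ℂ × ℂ :=
  (starRingEnd ℂ) (part.phase * h z) • (-(starRingEnd ℂ) z.2, (starRingEnd ℂ) z.1)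

theorem hasFDerivAt_hopfMap (t : ℝ) (p : Fin 3 → ℝ) :
    HasFDerivAt (hopfMap t) ((fderiv ℝ (hopfα t) p).prod (fderiv ℝ (hopfβ t) p)) p :=
  (differentiableAt_hopfα t p).hasFDerivAt.prodMk (differentiableAt_hopfβ t p).hasFDerivAt

theorem fderiv_hopfMap_batemanField (part : FieldPart) (h : ℂ × ℂ → ℂ) (t : ℝ) (p : Fin 3 → ℝ) :
    fderiv ℝ (hopfMap t) p (part.of (batemanField hopfα hopfβ h) t p) =
      hopfFactor t p • sphereField part h (hopfMap t p) := by
  have hV : ∀ i, part.of (batemanField hopfα hopfβ h) t p i =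
      (part.phase * h (hopfMap t p) * (grad (hopfα t) p ⨯₃ grad (hopfβ t) p) i).re := fun i => by
    rw [FieldPart.of_apply, batemanField, Pi.smul_apply, smul_eq_mul, mul_assoc]
    rfl
  have h1 : ∑ i, grad (hopfα t) p i * (grad (hopfα t) p ⨯₃ grad (hopfβ t) p) i = 0 :=
    dot_self_cross _ _
  have h2 : ∑ i, grad (hopfβ t) p i * (grad (hopfα t) p ⨯₃ grad (hopfβ t) p) i = 0 :=
    dot_cross_self _ _
  rw [(hasFDerivAt_hopfMap t p).fderiv, ContinuousLinearMap.prod_apply, fderiv_apply_eq_sum_grad,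
    fderiv_apply_eq_sum_grad]
  simp only [hV]
  rw [sum_mul_re_mul, sum_mul_re_mul, h1, h2, grad_hopfα_dot_conj_cross,
    grad_hopfβ_dot_conj_cross]
  ext1
  · simp only [sphereField, hopfMap, Prod.smul_fst, Complex.real_smul, smul_eq_mul]
    ring
  · simp only [sphereField, hopfMap, Prod.smul_snd, Complex.real_smul, smul_eq_mul]
    ring

/-! ## The inverse of the map to the sphere -/

/-- The inverse of `(α, β)` at time `t`, defined on the sphere without `(1, 0)`. -/
noncomputable def hopfInv (t : ℝ) (z : ℂ × ℂ) : Fin 3 → ℝ :=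
  -- `A` recovers the real part `r² - t² + 1` of the denominator `D` from the real part of `(1 - α)
  -- D = 2 + 2i(t - z)`. The third coordinate then comes from its imaginary part, the other two from
  -- `β D = 2(x - iy)`.
  let A := (2 - 2 * t * z.1.im) / (1 - z.1.re)
  ![(z.2.re * A - 2 * t * z.2.im) / 2, -(z.2.im * A + 2 * t * z.2.re) / 2,
    t - (2 * t * (1 - z.1.re) - z.1.im * A) / 2]

theorem hopfα_relations (t : ℝ) (p : Fin 3 → ℝ) :
    (1 - (hopfα t p).re) * (p 0 ^ 2 + p 1 ^ 2 + p 2 ^ 2 - t ^ 2 + 1) + 2 * t * (hopfα t p).im = 2 ∧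
    2 * t * (1 - (hopfα t p).re) -
      (hopfα t p).im * (p 0 ^ 2 + p 1 ^ 2 + p 2 ^ 2 - t ^ 2 + 1) = 2 * (t - p 2) := by
  have h : hopfα t p * hopfDen t p = ((p 0 ^ 2 + p 1 ^ 2 + p 2 ^ 2 - t ^ 2 - 1 : ℝ) : ℂ) +
      ((2 * p 2 : ℝ) : ℂ) * Complex.I := by
    rw [hopfα_mul_hopfDen]
    push_cast
    ring
  rw [hopfDen_eq] at h
  have h1 := congrArg Complex.re h
  have h2 := congrArg Complex.im h
  simp only [Complex.add_re, Complex.add_im, Complex.mul_re, Complex.mul_im, Complex.ofReal_re,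
    Complex.ofReal_im, Complex.I_re, Complex.I_im] at h1 h2
  constructor <;> linarith

theorem hopfβ_relations (t : ℝ) (p : Fin 3 → ℝ) :
    (hopfβ t p).re * (p 0 ^ 2 + p 1 ^ 2 + p 2 ^ 2 - t ^ 2 + 1) - 2 * t * (hopfβ t p).im =
      2 * p 0 ∧
    (hopfβ t p).im * (p 0 ^ 2 + p 1 ^ 2 + p 2 ^ 2 - t ^ 2 + 1) + 2 * t * (hopfβ t p).re =
      -(2 * p 1) := by
  have h : hopfβ t p * hopfDen t p = ((2 * p 0 : ℝ) : ℂ) + ((-(2 * p 1) : ℝ) : ℂ) * Complex.I := by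
    rw [hopfβ_mul_hopfDen]
    push_cast
    ring
  rw [hopfDen_eq] at h
  have h1 := congrArg Complex.re h
  have h2 := congrArg Complex.im h
  simp only [Complex.add_re, Complex.add_im, Complex.mul_re, Complex.mul_im, Complex.ofReal_re,
    Complex.ofReal_im, Complex.I_re, Complex.I_im] at h1 h2
  constructor <;> linarith

/-- If `Re α = 1`, eliminating `Im α` from the two relations leaves `x² + y² + (z - t)² + 1 = 0`. -/
theorem one_sub_re_hopfα_ne_zero (t : ℝ) (p : Fin 3 → ℝ) : 1 - (hopfα t p).re ≠ 0 := by
  intro h0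
  obtain ⟨h1, h2⟩ := hopfα_relations t p
  rw [h0] at h1 h2
  have h3 : 2 * (p 0 ^ 2 + p 1 ^ 2 + p 2 ^ 2 - t ^ 2 + 1) + 4 * t * (t - p 2) = 0 := by
    linear_combination -(p 0 ^ 2 + p 1 ^ 2 + p 2 ^ 2 - t ^ 2 + 1) * h1 - 2 * t * h2
  nlinarith [sq_nonneg (p 0), sq_nonneg (p 1), sq_nonneg (p 2 - t)]

theorem hopfInv_hopfMap (t : ℝ) (p : Fin 3 → ℝ) : hopfInv t (hopfMap t p) = p := by
  have hP := one_sub_re_hopfα_ne_zero t p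
  obtain ⟨h1, h2⟩ := hopfα_relations t p
  obtain ⟨h3, h4⟩ := hopfβ_relations t p
  have hA : (2 - 2 * t * (hopfα t p).im) / (1 - (hopfα t p).re) =
      p 0 ^ 2 + p 1 ^ 2 + p 2 ^ 2 - t ^ 2 + 1 := by
    rw [div_eq_iff hP]
    linarith
  funext i
  simp only [hopfInv, hopfMap, hA]
  fin_cases i
  · simp only [Fin.zero_eta, Matrix.cons_val]
    linarith
  · simp only [Fin.mk_one, Matrix.cons_val]
    linarith
  · simp only [Fin.reduceFinMk, Matrix.cons_val]
    linarith

theorem hopfMap_hopfInv (t : ℝ) {z : ℂ × ℂ}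
    (hz : z.1.re ^ 2 + z.1.im ^ 2 + z.2.re ^ 2 + z.2.im ^ 2 = 1) (h1 : 1 - z.1.re ≠ 0) :
    hopfMap t (hopfInv t z) = z := by
  set A := (2 - 2 * t * z.1.im) / (1 - z.1.re) with hA
  have hPA : (1 - z.1.re) * A = 2 - 2 * t * z.1.im := by
    rw [hA]
    field_simp
  have e0 : hopfInv t z 0 = (z.2.re * A - 2 * t * z.2.im) / 2 := rfl
  have e1 : hopfInv t z 1 = -(z.2.im * A + 2 * t * z.2.re) / 2 := rfl
  have e2 : hopfInv t z 2 = t - (2 * t * (1 - z.1.re) - z.1.im * A) / 2 := rfl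
  -- The sphere equation enters here: it makes `A` the real part of the denominator at the
  -- constructed point.
  have hr : hopfInv t z 0 ^ 2 + hopfInv t z 1 ^ 2 + hopfInv t z 2 ^ 2 - t ^ 2 + 1 = A := by
    rw [e0, e1, e2]
    clear_value A
    linear_combination (A ^ 2 + 4 * t ^ 2) / 4 * hz +
      (A / 2 - (1 - z.1.re) * A / 4 - 1 / 2 - t * z.1.im / 2) * hPA
  have hD := hopfDen_ne_zero t (hopfInv t z)
  have hDe : hopfDen t (hopfInv t z) = (A : ℂ) + ((2 * t : ℝ) : ℂ) * Complex.I := by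
    rw [hopfDen_eq, hr]
  ext1
  · refine mul_right_cancel₀ hD ?_
    simp only [hopfMap]
    have hN : hopfα t (hopfInv t z) * hopfDen t (hopfInv t z) =
        ((A - 2 : ℝ) : ℂ) + ((2 * hopfInv t z 2 : ℝ) : ℂ) * Complex.I := by
      rw [hopfα_mul_hopfDen, ← hr]
      push_cast
      ring
    rw [hN, hDe, e2]
    apply Complex.ext
    · simp only [Complex.add_re, Complex.mul_re, Complex.mul_im, Complex.ofReal_re,
        Complex.ofReal_im, Complex.I_re, Complex.I_im, Complex.add_im]
      linarith
    · simp only [Complex.add_re, Complex.mul_re, Complex.mul_im, Complex.ofReal_re,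
        Complex.ofReal_im, Complex.I_re, Complex.I_im, Complex.add_im]
      linarith
  · refine mul_right_cancel₀ hD ?_
    simp only [hopfMap]
    rw [hopfβ_mul_hopfDen, hDe, e0, e1]
    apply Complex.ext
    · simp only [Complex.add_re, Complex.sub_re, Complex.mul_re, Complex.mul_im, Complex.ofReal_re,
        Complex.ofReal_im, Complex.I_re, Complex.I_im, Complex.add_im, Complex.sub_im,
        Complex.re_ofNat, Complex.im_ofNat]
      ring
    · simp only [Complex.add_re, Complex.sub_re, Complex.mul_re, Complex.mul_im, Complex.ofReal_re,
        Complex.ofReal_im, Complex.I_re, Complex.I_im, Complex.add_im, Complex.sub_im,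
        Complex.re_ofNat, Complex.im_ofNat]
      ring

theorem differentiableAt_hopfInv (t : ℝ) {z : ℂ × ℂ} (hz : 1 - z.1.re ≠ 0) :
    DifferentiableAt ℝ (hopfInv t) z := by
  have a1 : DifferentiableAt ℝ (fun z : ℂ × ℂ => z.1.re) z :=
    Complex.reCLM.differentiableAt.comp z differentiableAt_fst
  have a2 : DifferentiableAt ℝ (fun z : ℂ × ℂ => z.1.im) z :=
    Complex.imCLM.differentiableAt.comp z differentiableAt_fst
  have a3 : DifferentiableAt ℝ (fun z : ℂ × ℂ => z.2.re) z :=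
    Complex.reCLM.differentiableAt.comp z differentiableAt_snd
  have a4 : DifferentiableAt ℝ (fun z : ℂ × ℂ => z.2.im) z :=
    Complex.imCLM.differentiableAt.comp z differentiableAt_snd
  rw [differentiableAt_pi]
  intro i
  fin_cases i <;> simp only [hopfInv, Fin.zero_eta, Fin.mk_one, Fin.reduceFinMk,
    Matrix.cons_val] <;> fun_prop (disch := exact hz)

/-- The chain rule for the left inverse `hopfInv`. It allows velocities in `ℝ³` to be compared after
pushing them to the sphere. -/
theorem injective_fderiv_hopfMap (t : ℝ) (p : Fin 3 → ℝ) :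
    Function.Injective (fderiv ℝ (hopfMap t) p) := by
  have h1 := (differentiableAt_hopfInv t (z := hopfMap t p)
    (one_sub_re_hopfα_ne_zero t p)).hasFDerivAt.comp p
      (hasFDerivAt_hopfMap t p).differentiableAt.hasFDerivAt
  have h2 : hopfInv t ∘ hopfMap t = id := funext (hopfInv_hopfMap t)
  rw [h2] at h1
  have h3 := h1.unique (hasFDerivAt_id p)
  refine Function.LeftInverse.injective (g := fderiv ℝ (hopfInv t) (hopfMap t p)) fun v => ?_
  exact congrArg (fun L => L v) h3

/-! ## Reparametrisation of closed orbits -/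

/-- A periodic curve that follows a vector field up to a positive change of speed is a closed field
line. -/
theorem isClosedFieldLine_of_reparam {E : Type*} [NormedAddCommGroup E] [NormedSpace ℝ E]
    {V : E → E} {C : Set E} {T : ℝ} (hT : 0 < T) {c : ℝ → E} {g : ℝ → ℝ} (hg : Continuous g)
    (hpos : ∀ s, 0 < g s) (hgT : Function.Periodic g T)
    (hc : ∀ s, HasDerivAt c (g s • V (c s)) s) (hcT : Function.Periodic c T)
    (hinj : InjOn c (Ico 0 T)) (hrange : range c = C) : IsClosedFieldLine V C := by
  -- New time with `dτ = g ds`, so that `c ∘ τ⁻¹` has velocity `V`; its period is `τ T`.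
  set τ : ℝ → ℝ := fun s => ∫ x in (0 : ℝ)..s, g x with hτ
  have hint : ∀ a b, IntervalIntegrable g MeasureTheory.volume a b :=
    fun a b => hg.intervalIntegrable a b
  have hd : ∀ s, HasDerivAt τ (g s) s := fun s => (hg.integral_hasStrictDerivAt 0 s).hasDerivAt
  have hmono : StrictMono τ := strictMono_of_hasDerivAt_pos hd hpos
  have h0 : τ 0 = 0 := by simp [hτ]
  have hTpos : 0 < τ T := h0 ▸ hmono hT
  have hcont : Continuous τ := continuous_iff_continuousAt.2 fun s => (hd s).continuousAt
  have hsurj : Function.Surjective τ := hcont.surjective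
    (hgT.tendsto_atTop_intervalIntegral_of_pos hTpos hT)
    (hgT.tendsto_atBot_intervalIntegral_of_pos hTpos hT)
  set e : ℝ ≃o ℝ := hmono.orderIsoOfSurjective τ hsurj with he
  have hτe : ∀ s, τ (e.symm s) = s := fun s => e.apply_symm_apply s
  have heτ : ∀ s, e.symm (τ s) = s := fun s => e.symm_apply_apply s
  have hadd : ∀ s, τ (s + T) = τ s + τ T := fun s => by
    simp only [hτ]
    rw [hgT.intervalIntegral_add_eq_add 0 s hint, zero_add]
  have hsymm : ∀ s, e.symm (s + τ T) = e.symm s + T := fun s => by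
    rw [← heτ (e.symm s + T), hadd, hτe]
  refine ⟨τ T, c ∘ e.symm, hTpos, fun s => ?_, fun s => ?_, ?_, ?_⟩
  · have h1 : HasDerivAt e.symm (g (e.symm s))⁻¹ s :=
      (hd _).of_local_left_inverse e.symm.continuous.continuousAt (hpos _).ne'
        (Filter.Eventually.of_forall hτe)
    convert! (hc (e.symm s)).scomp s h1 using 1
    rw [smul_smul, inv_mul_cancel₀ (hpos _).ne', one_smul]
    rfl
  · simp only [Function.comp_apply, hsymm]
    exact hcT _
  · have hmem : ∀ s ∈ Ico 0 (τ T), e.symm s ∈ Ico 0 T := fun s hs => by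
      constructor
      · rw [← heτ 0, h0]
        exact e.symm.monotone hs.1
      · rw [← heτ T]
        exact e.symm.strictMono hs.2
    intro a ha b hb hab
    exact e.symm.injective (hinj (hmem a ha) (hmem b hb) hab)
  · rw [← hrange]
    exact e.symm.surjective.range_comp c

/-! ### The Legendrian curve and its tangent -/

namespace FourierCurve

theorem R_sq (K : FourierCurve) (t : ℝ) : K.R t ^ 2 = 1 + K.X t ^ 2 + K.Y t ^ 2 + K.Z t ^ 2 :=
  Real.sq_sqrt (by positivity)

theorem R_pos (K : FourierCurve) (t : ℝ) : 0 < K.R t :=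
  Real.sqrt_pos.2 (by positivity)

theorem R_ne_zero (K : FourierCurve) (t : ℝ) : (K.R t : ℂ) ≠ 0 :=
  Complex.ofReal_ne_zero.2 (K.R_pos t).ne'

theorem R_sq_complex (K : FourierCurve) (t : ℝ) :
    (K.R t : ℂ) ^ 2 = 1 + (K.X t : ℂ) ^ 2 + (K.Y t : ℂ) ^ 2 + (K.Z t : ℂ) ^ 2 := by
  exact_mod_cast congrArg (fun r : ℝ => (r : ℂ)) (K.R_sq t)

/-- The numerators of the two complex coordinates of the curve. -/
noncomputable def num₁ (K : FourierCurve) (t : ℝ) : ℂ := 1 + K.Z t * Complex.I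

noncomputable def num₂ (K : FourierCurve) (t : ℝ) : ℂ := K.X t + K.Y t * Complex.I

theorem γ_eq (K : FourierCurve) (t : ℝ) : K.γ t = (K.num₁ t / K.R t, K.num₂ t / K.R t) := by
  ext1 <;> apply Complex.ext <;>
    simp [γ, num₁, num₂, Complex.div_ofReal_re, Complex.div_ofReal_im]

theorem hasDerivAt_R (K : FourierCurve) (t : ℝ) :
    HasDerivAt K.R ((K.X t * deriv K.X t + K.Y t * deriv K.Y t +
      K.Z t * (K.Y t * deriv K.X t - K.X t * deriv K.Y t)) / K.R t) t := by
  have h := ((((K.hasDerivAt_X t).pow 2).const_add 1).add ((K.hasDerivAt_Y t).pow 2)).add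
    ((K.hasDerivAt_Z t).pow 2)
  have hp : 1 + K.X t ^ 2 + K.Y t ^ 2 + K.Z t ^ 2 ≠ 0 := by positivity
  have hR := K.R_pos t
  convert! h.sqrt hp using 1
  change _ = _ / (2 * K.R t)
  field_simp
  simp
  ring

theorem hasDerivAt_num₁ (K : FourierCurve) (t : ℝ) :
    HasDerivAt K.num₁ ((K.Y t * deriv K.X t - K.X t * deriv K.Y t : ℝ) * Complex.I) t :=
  ((K.hasDerivAt_Z t).ofReal_comp.mul_const Complex.I).const_add 1

theorem hasDerivAt_num₂ (K : FourierCurve) (t : ℝ) :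
    HasDerivAt K.num₂ ((deriv K.X t : ℝ) + (deriv K.Y t : ℝ) * Complex.I) t :=
  (K.hasDerivAt_X t).ofReal_comp.add ((K.hasDerivAt_Y t).ofReal_comp.mul_const Complex.I)

/-- The complex determinant `u₁ u₂' - u₂ u₁'` of the numerators `u` and their derivatives. -/
noncomputable def numDet (K : FourierCurve) (t : ℝ) : ℂ :=
  K.num₁ t * ((deriv K.X t : ℝ) + (deriv K.Y t : ℝ) * Complex.I) -
    K.num₂ t * ((K.Y t * deriv K.X t - K.X t * deriv K.Y t : ℝ) * Complex.I)

/-- The curve is Legendrian: its tangent is a complex multiple of `v₁`. -/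
theorem hasDerivAt_γ (K : FourierCurve) (t : ℝ) :
    HasDerivAt K.γ ((K.numDet t / (K.R t : ℂ) ^ 2) •
      (-(starRingEnd ℂ) (K.γ t).2, (starRingEnd ℂ) (K.γ t).1)) t := by
  have hR := K.R_ne_zero t
  have hR2 := K.R_sq_complex t
  have h1 := (K.hasDerivAt_num₁ t).div (K.hasDerivAt_R t).ofReal_comp hR
  have h2 := (K.hasDerivAt_num₂ t).div (K.hasDerivAt_R t).ofReal_comp hR
  rw [show K.γ = fun t => (K.num₁ t / K.R t, K.num₂ t / K.R t) from funext K.γ_eq]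
  convert! h1.prodMk h2 using 1
  have hI := Complex.I_sq
  ext1
  · simp only [Prod.smul_mk, smul_eq_mul, map_div₀, Complex.conj_ofReal]
    push_cast
    field_simp
    simp only [numDet, num₁, num₂, map_add, map_mul, Complex.conj_ofReal, Complex.conj_I]
    push_cast
    rw [hR2]
    clear * - hI
    grind
  · simp only [Prod.smul_mk, smul_eq_mul, map_div₀, Complex.conj_ofReal]
    push_cast
    field_simp
    simp only [numDet, num₁, num₂, map_add, map_mul, Complex.conj_ofReal, Complex.conj_I, map_one]
    push_cast
    rw [hR2]
    clear * - hI
    grind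

theorem normSq_γ (K : FourierCurve) (t : ℝ) :
    (K.γ t).1.re ^ 2 + (K.γ t).1.im ^ 2 + (K.γ t).2.re ^ 2 + (K.γ t).2.im ^ 2 = 1 := by
  have hR := (K.R_pos t).ne'
  simp only [γ]
  field_simp
  linarith [K.R_sq t]

theorem γ_det_deriv (K : FourierCurve) (t : ℝ) :
    (K.γ t).1 * (deriv K.γ t).2 - (K.γ t).2 * (deriv K.γ t).1 = K.numDet t / (K.R t : ℂ) ^ 2 := by
  have h : (K.γ t).1 * (starRingEnd ℂ) (K.γ t).1 + (K.γ t).2 * (starRingEnd ℂ) (K.γ t).2 = 1 := by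
    rw [Complex.mul_conj, Complex.mul_conj, Complex.normSq_apply, Complex.normSq_apply]
    have := K.normSq_γ t
    exact_mod_cast (by linarith)
  rw [(K.hasDerivAt_γ t).deriv]
  simp only [Prod.smul_mk, smul_eq_mul]
  linear_combination (K.numDet t / (K.R t : ℂ) ^ 2) * h

end FourierCurve

/-- The determinant `z₁ z₂' - z₂ z₁'` has real part `γ' · v₁` and imaginary part `γ' · v₂`; the
phase makes both cases its conjugate. -/
theorem phase_mul_targetH (part : FieldPart) (K : FourierCurve) (t : ℝ) :
    part.phase * targetH part K t = (starRingEnd ℂ) (K.numDet t) / (K.R t : ℂ) ^ 2 := by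
  have h := congrArg (starRingEnd ℂ) (K.γ_det_deriv t)
  rw [map_div₀, map_pow, Complex.conj_ofReal] at h
  rw [← h]
  cases part
  · apply Complex.ext
    · simp [FieldPart.phase, targetH, realDot, v₁, v₂]
      ring
    · simp [FieldPart.phase, targetH, realDot, v₁, v₂]
      ring
  · apply Complex.ext
    · simp [FieldPart.phase, targetH, realDot, v₁, v₂]
      ring
    · simp [FieldPart.phase, targetH, realDot, v₁, v₂]
      ring

theorem FieldPart.phase_ne_zero (part : FieldPart) : part.phase ≠ 0 := by
  cases part <;> simp [FieldPart.phase]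

/-! ### Degree bounds along the curve and periodicity -/

namespace FourierCurve

theorem num₁_mem_trigSpan {K : FourierCurve} (hK : K.Balanced) : K.num₁ ∈ trigSpan K.deg := by
  have h := Submodule.add_mem _ (const_mem_trigSpan 1 K.deg)
    (Submodule.smul_mem _ Complex.I (K.deg_spec hK).2.2.mem_trigSpan)
  convert! h using 1
  funext t
  simp [num₁, mul_comm]

theorem num₂_mem_trigSpan {K : FourierCurve} (hK : K.Balanced) : K.num₂ ∈ trigSpan K.deg := by
  have h := Submodule.add_mem _ (K.deg_spec hK).1.mem_trigSpan
    (Submodule.smul_mem _ Complex.I (K.deg_spec hK).2.1.mem_trigSpan)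
  convert! h using 1
  funext t
  simp [num₂, mul_comm]

theorem R_sq_mem_trigSpan {K : FourierCurve} (hK : K.Balanced) :
    (fun t => (K.R t : ℂ) ^ 2) ∈ trigSpan (K.deg * 2) := by
  obtain ⟨hX, hY, hZ⟩ := K.deg_spec hK
  have h := Submodule.add_mem _ (Submodule.add_mem _ (Submodule.add_mem _
    (const_mem_trigSpan 1 (K.deg * 2)) (pow_mem_trigSpan hX.mem_trigSpan 2))
    (pow_mem_trigSpan hY.mem_trigSpan 2)) (pow_mem_trigSpan hZ.mem_trigSpan 2)
  convert! h using 1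
  funext t
  exact K.R_sq_complex t

theorem isTrigPolynomial_deriv {f : ℝ → ℝ} {m : ℕ} (h : IsTrigPolynomial f m) :
    IsTrigPolynomial (deriv f) m := by
  obtain ⟨g, hg, hd⟩ := h.exists_hasDerivAt
  rwa [show deriv f = g from funext fun t => (hd t).deriv]

/-- Using `Z'` as the derivative of `Z`, of degree at most `deg`, rather than as `Y X' - X Y'`,
keeps the total at `2 * deg`. -/
theorem conj_numDet_mem_trigSpan {K : FourierCurve} (hK : K.Balanced) :
    (fun t => (starRingEnd ℂ) (K.numDet t)) ∈ trigSpan (K.deg + K.deg) := by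
  obtain ⟨hX, hY, hZ⟩ := K.deg_spec hK
  have hX' := (isTrigPolynomial_deriv hX).mem_trigSpan
  have hY' := (isTrigPolynomial_deriv hY).mem_trigSpan
  have hZ' := (isTrigPolynomial_deriv hZ).mem_trigSpan
  have h := Submodule.sub_mem _
    (mul_mem_trigSpan (Submodule.sub_mem _ (const_mem_trigSpan 1 K.deg)
      (Submodule.smul_mem _ Complex.I hZ.mem_trigSpan))
      (Submodule.sub_mem _ hX' (Submodule.smul_mem _ Complex.I hY')))
    (mul_mem_trigSpan (Submodule.sub_mem _ hX.mem_trigSpan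
      (Submodule.smul_mem _ Complex.I hY.mem_trigSpan)) (Submodule.smul_mem _ (-Complex.I) hZ'))
  convert! h using 1
  funext t
  simp only [numDet, num₁, num₂, map_sub, map_add, map_mul, map_one, Complex.conj_ofReal,
    Complex.conj_I, Pi.sub_apply, Pi.mul_apply, Pi.smul_apply, smul_eq_mul,
    (K.hasDerivAt_Z t).deriv]
  ring

/-- The monomial `z₁ⁱ z₂ʲ` along the curve, cleared of denominators. -/
theorem monomial_mem_trigSpan {K : FourierCurve} (hK : K.Balanced) {n i j : ℕ}
    (hi : i ≤ n) (hj : j ≤ n) (hij : Even (i + j)) :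
    (fun t => (K.R t : ℂ) ^ (2 * n) * ((K.γ t).1 ^ i * (K.γ t).2 ^ j)) ∈
      trigSpan (2 * K.deg * n) := by
  -- With `i + j = 2k` the function is `(R²)^(n-k) num₁^i num₂^j`, free of square roots.
  obtain ⟨k, hk⟩ := hij
  have hkn : k ≤ n := by omega
  have h := mul_mem_trigSpan (pow_mem_trigSpan (R_sq_mem_trigSpan hK) (n - k))
    (mul_mem_trigSpan (pow_mem_trigSpan (num₁_mem_trigSpan hK) i)
      (pow_mem_trigSpan (num₂_mem_trigSpan hK) j))
  have e : K.deg * 2 * (n - k) + (K.deg * i + K.deg * j) = 2 * K.deg * n := by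
    obtain ⟨d, rfl⟩ := Nat.exists_eq_add_of_le hkn
    rw [← mul_add, hk, Nat.add_sub_cancel_left]
    ring
  rw [e] at h
  convert! h using 1
  funext t
  have hR := K.R_ne_zero t
  have e2 : 2 * n = 2 * (n - k) + (i + j) := by omega
  simp only [Pi.mul_apply, Pi.pow_apply, K.γ_eq t, div_pow]
  rw [e2, pow_add, pow_add, pow_mul]
  field_simp

theorem targetH_mem_trigSpan {K : FourierCurve} (hK : K.Balanced) (part : FieldPart) {n : ℕ}
    (hn : 1 ≤ n) :
    (fun t => (K.R t : ℂ) ^ (2 * n) * targetH part K t) ∈ trigSpan (2 * K.deg * n) := by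
  -- `H` has denominator `R²`, so clearing it costs one factor `R²`; hence `n ≥ 1`.
  have h := Submodule.smul_mem _ (part.phase)⁻¹ (mul_mem_trigSpan
    (pow_mem_trigSpan (R_sq_mem_trigSpan hK) (n - 1)) (conj_numDet_mem_trigSpan hK))
  obtain ⟨d, rfl⟩ := Nat.exists_eq_add_of_le' hn
  have e : K.deg * 2 * (d + 1 - 1) + (K.deg + K.deg) = 2 * K.deg * (d + 1) := by
    rw [Nat.add_sub_cancel]
    ring
  rw [e] at h
  convert! h using 1
  funext t
  have hR := K.R_ne_zero t
  have hp := part.phase_ne_zero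
  have ht : targetH part K t =
      (part.phase)⁻¹ * ((starRingEnd ℂ) (K.numDet t) / (K.R t : ℂ) ^ 2) := by
    rw [← phase_mul_targetH, inv_mul_cancel_left₀ hp]
  simp only [Pi.mul_apply, Pi.pow_apply, Pi.smul_apply, smul_eq_mul, ht, Nat.add_sub_cancel]
  rw [mul_add, pow_add, pow_mul]
  field_simp

theorem periodic_γ {K : FourierCurve} (hK : K.Balanced) : Function.Periodic K.γ (2 * π) := by
  intro t
  have h1 := periodic_of_mem_trigSpan (num₁_mem_trigSpan hK) t
  have h2 := periodic_of_mem_trigSpan (num₂_mem_trigSpan hK) t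
  have h3 : K.R (t + 2 * π) = K.R t := by
    have h := periodic_of_mem_trigSpan (R_sq_mem_trigSpan hK) t
    have h' : K.R (t + 2 * π) ^ 2 = K.R t ^ 2 := by exact_mod_cast h
    exact (pow_left_inj₀ (K.R_pos _).le (K.R_pos _).le two_ne_zero).1 h'
  rw [K.γ_eq, K.γ_eq, h1, h2, h3]

theorem one_sub_re_γ_ne_zero {K : FourierCurve} (h : ((1, 0) : ℂ × ℂ) ∉ K.image) (t : ℝ) :
    1 - (K.γ t).1.re ≠ 0 := by
  intro h0
  refine h ⟨t, ?_⟩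
  have h1 : (K.γ t).1.re = 1 := by linarith
  have h2 := K.normSq_γ t
  rw [h1] at h2
  have h3 : (K.γ t).1.im = 0 := by nlinarith [sq_nonneg (K.γ t).2.re, sq_nonneg (K.γ t).2.im]
  have h4 : (K.γ t).2.re = 0 := by nlinarith [sq_nonneg (K.γ t).2.re, sq_nonneg (K.γ t).2.im]
  have h5 : (K.γ t).2.im = 0 := by nlinarith [sq_nonneg (K.γ t).2.re, sq_nonneg (K.γ t).2.im]
  exact Prod.ext (Complex.ext h1 h3) (Complex.ext h4 h5)

end FourierCurve

/-! ## Field lines -/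

theorem hasDerivAt_γ_sphereField {K : FourierCurve} {part : FieldPart} {h : ℂ × ℂ → ℂ} {t : ℝ}
    (ht : h (K.γ t) = targetH part K t) :
    HasDerivAt K.γ (sphereField part h (K.γ t)) t := by
  rw [sphereField, ht, phase_mul_targetH, map_div₀, map_pow, Complex.conj_ofReal, Complex.conj_conj]
  exact K.hasDerivAt_γ t

theorem isClosedFieldLine_sphereField {K : FourierCurve} (hK : K.Balanced)
    (hinj : InjOn K.γ (Ico 0 (2 * π))) {part : FieldPart} {h : ℂ × ℂ → ℂ}
    (hh : ∀ t, h (K.γ t) = targetH part K t) :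
    IsClosedFieldLine (sphereField part h) K.image :=
  ⟨2 * π, K.γ, by positivity, fun s => hasDerivAt_γ_sphereField (hh s),
    FourierCurve.periodic_γ hK, hinj, rfl⟩

theorem isClosedFieldLine_preimage {K : FourierCurve} (hK : K.Balanced)
    (hinj : InjOn K.γ (Ico 0 (2 * π))) {part : FieldPart} {h : ℂ × ℂ → ℂ}
    (hh : ∀ t, h (K.γ t) = targetH part K t) (t : ℝ) (hne : ((1, 0) : ℂ × ℂ) ∉ K.image) :
    IsClosedFieldLine (part.of (batemanField hopfα hopfβ h) t) (hopfMap t ⁻¹' K.image) := by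
  have hP := FourierCurve.one_sub_re_γ_ne_zero hne
  set c : ℝ → Fin 3 → ℝ := fun s => hopfInv t (K.γ s) with hc
  have hmap : ∀ s, hopfMap t (c s) = K.γ s := fun s => hopfMap_hopfInv t (K.normSq_γ s) (hP s)
  have hdiff : ∀ s, DifferentiableAt ℝ c s := fun s =>
    (differentiableAt_hopfInv t (hP s)).comp s (K.hasDerivAt_γ s).differentiableAt
  have hcont : Continuous c := continuous_iff_continuousAt.2 fun s => (hdiff s).continuousAt
  have hperiod : Function.Periodic c (2 * π) := fun s => by
    simp only [hc, FourierCurve.periodic_γ hK s]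
  refine isClosedFieldLine_of_reparam (T := 2 * π) (by positivity) (c := c)
    -- On the sphere `c` moves with the sphere field, while the field in `ℝ³` pushes forward to
    -- `hopfFactor` times it.
    (g := fun s => (hopfFactor t (c s))⁻¹)
    (((continuous_hopfFactor t).comp hcont).inv₀ fun s => (hopfFactor_pos t _).ne')
    (fun s => inv_pos.2 (hopfFactor_pos t _)) (fun s => by simp only [hperiod s]) (fun s => ?_)
    hperiod (fun a ha b hb hab => hinj ha hb (by rw [← hmap a, ← hmap b, hab])) ?_
  · have h1 := (hasFDerivAt_hopfMap t (c s)).differentiableAt.hasFDerivAt.comp_hasDerivAt s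
      (hdiff s).hasDerivAt
    rw [show hopfMap t ∘ c = K.γ from funext hmap] at h1
    have h2 := h1.unique (hasDerivAt_γ_sphereField (hh s))
    have h3 : deriv c s =
        (hopfFactor t (c s))⁻¹ • part.of (batemanField hopfα hopfβ h) t (c s) := by
      apply injective_fderiv_hopfMap t (c s)
      rw [h2, map_smul, fderiv_hopfMap_batemanField, smul_smul,
        inv_mul_cancel₀ (hopfFactor_pos t _).ne', one_smul, hmap]
    rw [← h3]
    exact (hdiff s).hasDerivAt
  · ext p
    constructor
    · rintro ⟨s, rfl⟩
      exact ⟨s, (hmap s).symm⟩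
    · rintro ⟨s, hs⟩
      refine ⟨s, ?_⟩
      rw [hc]
      dsimp only
      rw [hs, hopfInv_hopfMap]

/-! ## The polynomials and the linear systems -/

theorem polyFun_polyOf {n : ℕ} (x : EvenIndex n → ℂ) (z : ℂ × ℂ) :
    polyFun (polyOf x) z = ∑ p, x p * (z.1 ^ (p.1.1 : ℕ) * z.2 ^ (p.1.2 : ℕ)) := by
  simp [polyFun, polyOf, mul_assoc]

theorem contDiff_polyFun {n : ℕ} (x : EvenIndex n → ℂ) {𝕜 : Type*} [NontriviallyNormedField 𝕜]
    [NormedAlgebra 𝕜 ℂ] : ContDiff 𝕜 ∞ (polyFun (polyOf x)) := by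
  rw [show polyFun (polyOf x) = _ from funext (polyFun_polyOf x)]
  exact ContDiff.sum fun p _ => contDiff_const.mul
    ((contDiff_fst.pow _).mul (contDiff_snd.pow _))

theorem contDiff_sphereField (part : FieldPart) {h : ℂ × ℂ → ℂ} (hh : ContDiff ℝ ∞ h) :
    ContDiff ℝ ∞ (sphereField part h) := by
  have hconj : ContDiff ℝ ∞ (starRingEnd ℂ) := Complex.conjCLE.contDiff
  exact (hconj.comp (contDiff_const.mul hh)).smul
    ((hconj.comp contDiff_snd).neg.prodMk (hconj.comp contDiff_fst))

theorem isBatemanFieldOfHopfType_polyFun {n : ℕ} (x : EvenIndex n → ℂ) :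
    IsBatemanFieldOfHopfType (batemanField hopfα hopfβ (polyFun (polyOf x))) :=
  ⟨isBatemanPair_hopf, Set.univ, polyFun (polyOf x), isOpen_univ, fun _ _ => mem_univ _,
    ((contDiff_polyFun x).differentiable (by simp)).differentiableOn, fun _ _ => rfl⟩

theorem hasClosedFieldLines_of_eq_targetH {l : ℕ} (L : FourierLink l) {n : ℕ}
    (x : EvenIndex n → ℂ) (part : FieldPart)
    (hx : ∀ k t, polyFun (polyOf x) ((L.comp k).γ t) = targetH part (L.comp k) t) :
    HasClosedFieldLines (part.of (batemanField hopfα hopfβ (polyFun (polyOf x)))) L :=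
  ⟨⟨sphereField part (polyFun (polyOf x)), ⟨contDiff_sphereField part (contDiff_polyFun x),
      fun t p => ⟨hopfFactor t p, hopfFactor_pos t p, fderiv_hopfMap_batemanField part _ t p⟩⟩,
      fun k => isClosedFieldLine_sphereField (L.balanced k) (L.simple k) (hx k)⟩,
    fun t k hk => isClosedFieldLine_preimage (L.balanced k) (L.simple k) (hx k) t hk⟩

theorem totalDegree_polyOf_le {n : ℕ} (x : EvenIndex n → ℂ) :
    (polyOf x).totalDegree ≤ 2 * n := by
  refine MvPolynomial.totalDegree_finsetSum_le fun p _ => ?_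
  have h1 := MvPolynomial.totalDegree_mul
    (MvPolynomial.C (x p) * (MvPolynomial.X 0 : MvPolynomial (Fin 2) ℂ) ^ (p.1.1 : ℕ))
    (MvPolynomial.X 1 ^ (p.1.2 : ℕ))
  have h2 := MvPolynomial.totalDegree_mul (MvPolynomial.C (x p))
    ((MvPolynomial.X 0 : MvPolynomial (Fin 2) ℂ) ^ (p.1.1 : ℕ))
  rw [MvPolynomial.totalDegree_C, MvPolynomial.totalDegree_X_pow] at h2
  rw [MvPolynomial.totalDegree_X_pow] at h1
  have := p.1.1.2
  have := p.1.2.2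
  omega

theorem polyOf_ne_zero {n : ℕ} {x : EvenIndex n → ℂ} (hx : x ≠ 0) : polyOf x ≠ 0 := by
  obtain ⟨p, hp⟩ := Function.ne_iff.1 hx
  intro h0
  apply hp
  have e : polyOf x = ∑ q : EvenIndex n, MvPolynomial.monomial
      (Finsupp.single 0 (q.1.1 : ℕ) + Finsupp.single 1 (q.1.2 : ℕ)) (x q) := by
    refine Finset.sum_congr rfl fun q _ => ?_
    rw [mul_assoc, MvPolynomial.X_pow_eq_monomial, MvPolynomial.X_pow_eq_monomial,
      MvPolynomial.monomial_mul, MvPolynomial.C_mul_monomial]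
    simp
  have h1 := congrArg (MvPolynomial.coeff
    (Finsupp.single 0 (p.1.1 : ℕ) + Finsupp.single 1 (p.1.2 : ℕ))) (e.symm.trans h0)
  rw [MvPolynomial.coeff_sum, Finset.sum_eq_single p, MvPolynomial.coeff_monomial, if_pos rfl] at h1
  · simpa using h1
  · intro q _ hqp
    rw [MvPolynomial.coeff_monomial, if_neg]
    intro h
    apply hqp
    have h2 := DFunLike.congr_fun h 0
    have h3 := DFunLike.congr_fun h 1
    simp at h2 h3
    exact Subtype.ext (Prod.ext (Fin.ext h2) (Fin.ext h3))
  · exact fun h => absurd (Finset.mem_univ _) h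

theorem exists_isExpansionMatrix {l : ℕ} (L : FourierLink l) (n : ℕ) :
    ∃ A : Matrix (Row L n) (EvenIndex n) ℂ, IsExpansionMatrix L n A := by
  have h : ∀ (k : Fin l) (p : EvenIndex n), ∃ v : TrigIndex (2 * (L.comp k).deg * n) → ℂ,
      ∀ t, ((L.comp k).R t : ℂ) ^ (2 * n) *
        (((L.comp k).γ t).1 ^ (p.1.1 : ℕ) * ((L.comp k).γ t).2 ^ (p.1.2 : ℕ)) =
        ∑ r, v r * (trigBasis r t : ℂ) := fun k p =>
    exists_trigBasis_expansion (FourierCurve.monomial_mem_trigSpan (L.balanced k)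
      (Nat.lt_succ_iff.1 p.1.1.2) (Nat.lt_succ_iff.1 p.1.2.2) p.2)
  choose v hv using h
  refine ⟨fun r p => v r.1 p r.2, fun x k t => ?_⟩
  dsimp only
  rw [polyFun_polyOf, Finset.mul_sum]
  simp only [Matrix.mulVec, dotProduct, Finset.sum_mul]
  rw [Finset.sum_comm]
  refine Finset.sum_congr rfl fun p _ => ?_
  rw [mul_left_comm, hv, Finset.mul_sum]
  refine Finset.sum_congr rfl fun r _ => ?_
  ring

/-- For each `i`, the values `2q + i % 2` with `q < n / 2` are exponents at most `n` of the same
parity as `i`. -/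
theorem card_evenIndex_ge (n : ℕ) : (n + 1) * (n / 2) ≤ Fintype.card (EvenIndex n) := by
  have h : Function.Injective fun q : Fin (n + 1) × Fin (n / 2) =>
      (⟨(q.1, ⟨2 * q.2 + q.1 % 2, by omega⟩), by
        rw [Nat.even_iff]
        dsimp only
        omega⟩ : EvenIndex n) := by
    intro q q' h
    simp only [Subtype.mk.injEq, Prod.mk.injEq, Fin.mk.injEq] at h
    obtain ⟨h1, h2⟩ := h
    rw [h1] at h2
    exact Prod.ext h1 (Fin.ext (by omega))
  simpa using Fintype.card_le_of_injective _ h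

theorem card_row {l : ℕ} (L : FourierLink l) (n : ℕ) :
    Fintype.card (Row L n) = 4 * (∑ k, (L.comp k).deg) * n + l := by
  simp only [Row, TrigIndex, Fintype.card_sigma, Fintype.card_sum, Fintype.card_fin]
  rw [Finset.mul_sum, Finset.sum_mul]
  have h : ∀ k : Fin l, 2 * (L.comp k).deg * n + 1 + 2 * (L.comp k).deg * n =
      4 * (L.comp k).deg * n + 1 := fun k => by ring
  simp [h, Finset.sum_add_distrib]

theorem card_row_lt_card_evenIndex {l : ℕ} (L : FourierLink l) {n : ℕ}
    (hn : 2 * (4 * (∑ k, (L.comp k).deg) + l + 1) ≤ n) :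
    Fintype.card (Row L n) < Fintype.card (EvenIndex n) := by
  refine lt_of_lt_of_le ?_ (card_evenIndex_ge n)
  rw [card_row]
  set M := 4 * ∑ k, (L.comp k).deg
  -- The threshold gives at least `(n + 1) * (M + l + 1)` unknowns against `M * n + l` equations.
  have h1 : M + l + 1 ≤ n / 2 := by omega
  have h2 := Nat.mul_le_mul_left (n + 1) h1
  nlinarith

theorem exists_mulVec_eq_zero_of_card_lt {r c 𝕜 : Type*} [Field 𝕜] [Fintype r] [Fintype c]
    (A : Matrix r c 𝕜) (h : Fintype.card r < Fintype.card c) : ∃ x, x ≠ 0 ∧ A *ᵥ x = 0 := by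
  have hker : LinearMap.ker A.mulVecLin ≠ ⊥ :=
    LinearMap.ker_ne_bot_of_finrank_lt (by simpa using h)
  obtain ⟨x, hx, hx0⟩ := Submodule.exists_mem_ne_zero_of_ne_bot hker
  exact ⟨x, hx0, hx⟩

theorem theorem2 {l : ℕ} (L : FourierLink l) :
    ∃ A : (n : ℕ) → Matrix (Row L n) (EvenIndex n) ℂ,
      (∀ n, IsExpansionMatrix L n (A n)) ∧
      -- part (i)
      (∀ n, ∀ x : EvenIndex n → ℂ, x ≠ 0 → A n *ᵥ x = 0 →
        polyOf x ≠ 0 ∧ (polyOf x).totalDegree ≤ 2 * n ∧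
          ∀ z ∈ L.carrier, polyFun (polyOf x) z = 0) ∧
      (∃ n₀, ∀ n, n₀ ≤ n → ∃ x : EvenIndex n → ℂ, x ≠ 0 ∧ A n *ᵥ x = 0) ∧
      -- part (ii)
      (∀ n, 1 ≤ n → ∀ part : FieldPart, ∃ y : Row L n → ℂ,
        IsTrigExpansion L
          (fun k t => ((L.comp k).R t : ℂ) ^ (2 * n) * targetH part (L.comp k) t) y ∧
        ∀ x : EvenIndex n → ℂ, A n *ᵥ x = y →
          (polyOf x).totalDegree ≤ 2 * n ∧
          IsBatemanFieldOfHopfType (batemanField hopfα hopfβ (polyFun (polyOf x))) ∧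
          HasClosedFieldLines (part.of (batemanField hopfα hopfβ (polyFun (polyOf x)))) L) := by
  choose A hA using exists_isExpansionMatrix L
  refine ⟨A, hA, fun n x hx hAx => ⟨polyOf_ne_zero hx, totalDegree_polyOf_le x, ?_⟩,
    ⟨_, fun n hn => exists_mulVec_eq_zero_of_card_lt (A n) (card_row_lt_card_evenIndex L hn)⟩,
    fun n hn part => ?_⟩
  · intro z hz
    obtain ⟨k, t, rfl⟩ := mem_iUnion.1 hz
    have h := hA n x k t
    rw [hAx] at h
    simp only [Pi.zero_apply, zero_mul, Finset.sum_const_zero] at h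
    exact (mul_eq_zero.1 h).resolve_left (pow_ne_zero _ ((L.comp k).R_ne_zero t))
  · choose y hy using fun k => exists_trigBasis_expansion
      (FourierCurve.targetH_mem_trigSpan (L.balanced k) part hn)
    refine ⟨fun r => y r.1 r.2, hy, fun x hx => ⟨totalDegree_polyOf_le x,
      isBatemanFieldOfHopfType_polyFun x, hasClosedFieldLines_of_eq_targetH L x part ?_⟩⟩
    intro k t
    have h := hA n x k t
    -- Equal coefficients give equal functions, and cancelling `R^{2n}` yields `h = H` on the
    -- component.
    rw [hx] at h
    exact mul_left_cancel₀ (pow_ne_zero _ ((L.comp k).R_ne_zero t)) (h.trans (hy k t).symm)
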